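/- Let $\mathbf{Gpd}^{G}$ ($G=\mathbb{Z}/2\mathbb{Z}$) be the category of groupoids equipped with an involution and equivariant functors, equipped with the projective fibrations: the equivariant functors whose underlying functor is an isofibration. An acyclic cofibration is a morphism with the left lifting property with respect to all fibrations. A path object of $f:X\to B$ is a factorization of the diagonal $X\to X\times_B X$ as an acyclic cofibration followed by a fibration; a path object of an object $Y$ is one of $Y\to\mathbf 1$. Two morphisms $f,g:X\to Y$ are right homotopic if $\langle f,g\rangle:X\to Y\times Y$ lifts to a path object of $Y$, and a homotopy equivalence is a morphism with an inverse up to right homotopy. Let $\kappa$ be an inaccessible cardinal. Let $U_\Delta$ be the groupoid whose objects are the triples $(A_0,A_1,\varphi)$, where $A_0,A_1$ are $\kappa$-small discrete groupoids (sets) and $\varphi:A_0\cong A_1$, and whose morphisms $(A_0,A_1,\varphi)\to(B_0,B_1,\psi)$ are the pairs of bijections $\rho_0:A_0\to B_0$, $\rho_1:A_1\to B_1$ with $\psi\rho_0=\rho_1\varphi$, with the involution $(A_0,A_1,\varphi)\mapsto(A_1,A_0,\varphi^{-1})$, $(\rho_0,\rho_1)\mapsto(\rho_1,\rho_0)$.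 Let $\widetilde U_\Delta$ be the groupoid of objects $(A_0,A_1,\varphi)$ of $U_\Delta$ with a point $a\in A_0$ and of point-preserving morphisms, with the involution $(A_0,A_1,a,\varphi)\mapsto(A_1,A_0,\varphi(a),\varphi^{-1})$, and let $p_\Delta:\widetilde U_\Delta\to U_\Delta$ be the forgetful morphism. Let $E\to U_\Delta\times U_\Delta$ be an interpretation of the dependent type, in context $(A,B:\mathrm{Type})$, $$\mathrm{Equiv}(A,B):=\sum_{f:A\to B}\Big[\Big(\sum_{s:B\to A}\prod_{b:B}f(s(b))=b\Big)\times\Big(\sum_{r:B\to A}\prod_{a:A}r(f(a))=a\Big)\Big],$$ where types in the universe are pullbacks of $p_\Delta$, $\sum$ is composition, $\prod$ is the right adjoint of pullback (function types are $\prod$ of a pulled back type), binary products are fibre products, and identity types are pullbacks of a path object of $p_\Delta$ over $U_\Delta$. Let $U_\Delta\to E$ be the morphism over $U_\Delta\times U_\Delta$ that maps a type to its identity equivalence. One says that $p_\Delta$ is univalent if this morphism is a homotopy equivalence. Proposition. Such an interpretation $E$ exists, and the universe $p_\Delta$ is not univalent. More precisely, for every such interpretation $E$: 1. there is a fixed point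 of the involution of $E$ that lies over $(A,A)$, where $A=(\mathbb{Z},\mathbb{Z},1_{\mathbb Z})$, whose underlying function is $n\mapsto -n$, and that is not the image of a fixed point of $U_\Delta$; 2. the map induced by $U_\Delta\to E$ on fixed points is not bijective; 3. $U_\Delta\to E$ is not a homotopy equivalence. -/

import Mathlib

open CategoryTheory Limits

universe v u

section TypeTheoreticNotions

variable {C : Type u} [Category.{v} C]

/-- A pullback of `p : E ⟶ B` along `f : X ⟶ B`, i.e. an interpretation of the substitution of the
type `p` along `f`: `proj` is the pulled back morphism and `top` the morphism above `f`. -/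
structure PullbackData {X E B : C} (f : X ⟶ B) (p : E ⟶ B) where
  obj : C
  proj : obj ⟶ X
  top : obj ⟶ E
  isPullback : IsPullback proj top f p

/-- The morphism to the pullback given by a compatible pair. -/
noncomputable def PullbackData.lift {X E B Y : C} {f : X ⟶ B} {p : E ⟶ B} (P : PullbackData f p)
    (a : Y ⟶ X) (e : Y ⟶ E) (h : a ≫ f = e ≫ p) : Y ⟶ P.obj :=
  P.isPullback.lift a e h

theorem PullbackData.lift_proj {X E B Y : C} {f : X ⟶ B} {p : E ⟶ B} (P : PullbackData f p)
    (a : Y ⟶ X) (e : Y ⟶ E) (h : a ≫ f = e ≫ p) : P.lift a e h ≫ P.proj = a :=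
  P.isPullback.lift_fst a e h

theorem PullbackData.lift_top {X E B Y : C} {f : X ⟶ B} {p : E ⟶ B} (P : PullbackData f p)
    (a : Y ⟶ X) (e : Y ⟶ E) (h : a ≫ f = e ≫ p) : P.lift a e h ≫ P.top = e :=
  P.isPullback.lift_snd a e h

theorem PullbackData.hom_ext {X E B Y : C} {f : X ⟶ B} {p : E ⟶ B} (P : PullbackData f p)
    {k l : Y ⟶ P.obj} (h₁ : k ≫ P.proj = l ≫ P.proj) (h₂ : k ≫ P.top = l ≫ P.top) : k = l :=
  P.isPullback.hom_ext h₁ h₂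

/-- Given a pullback `P` of `p` along `f : X ⟶ B` and `h : Y ⟶ X`, if the morphism
`q : Q ⟶ Y` is a pullback of `p` along `h ≫ f`, it is also a pullback of `P.proj` along `h`. -/
noncomputable abbrev PullbackData.restrict {X E B Y Q : C} {f : X ⟶ B} {p : E ⟶ B}
    (P : PullbackData f p) (h : Y ⟶ X) (q : Q ⟶ Y) (t : Q ⟶ E)
    (H : IsPullback q t (h ≫ f) p) : PullbackData h P.proj where
  obj := Q
  proj := q
  top := P.lift (q ≫ h) t (by simpa using H.w)
  isPullback := IsPullback.of_bot (by rw [P.lift_top]; exact H)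
    (P.lift_proj _ _ _).symm P.isPullback

/-- A dependent product `Π_g f` of `f : D ⟶ A` along `g : A ⟶ B`: the value at `f` of the partial
right adjoint of the pullback functor `g^* : C/B ⥤ C/A`. It is an object `proj : obj ⟶ B` over `B`
with a morphism `ev : g^* obj ⟶ D` over `A` which is universal: every morphism `g^* X ⟶ D` over
`A`, where `X` is over `B`, is induced by a unique morphism `X ⟶ obj` over `B`. -/
structure DepProd {A B D : C} (g : A ⟶ B) (f : D ⟶ A) where
  obj : C
  proj : obj ⟶ B
  pb : PullbackData proj g
  ev : pb.obj ⟶ D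
  ev_comp : ev ≫ f = pb.top
  universal : ∀ {X : C} (h : X ⟶ B) (Q : PullbackData h g) (w : Q.obj ⟶ D), w ≫ f = Q.top →
    ∃! k : X ⟶ obj, ∃ hk : k ≫ proj = h,
      pb.lift (Q.proj ≫ k) Q.top
        (by rw [Category.assoc, hk]; exact Q.isPullback.w) ≫ ev = w

/-- The morphism `X ⟶ Π_g f` over `B` that corresponds to a morphism `g^* X ⟶ D` over `A`. -/
noncomputable def DepProd.lam {A B D X : C} {g : A ⟶ B} {f : D ⟶ A} (P : DepProd g f) (h : X ⟶ B)
    (Q : PullbackData h g) (w : Q.obj ⟶ D) (hw : w ≫ f = Q.top) : X ⟶ P.obj :=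
  (P.universal h Q w hw).choose

theorem DepProd.lam_proj {A B D X : C} {g : A ⟶ B} {f : D ⟶ A} (P : DepProd g f) (h : X ⟶ B)
    (Q : PullbackData h g) (w : Q.obj ⟶ D) (hw : w ≫ f = Q.top) :
    P.lam h Q w hw ≫ P.proj = h :=
  (P.universal h Q w hw).choose_spec.1.1

/-- Application: the value of the family of partial sections `k : X ⟶ Π_g f` at the argument
`x : X ⟶ A`. -/
noncomputable def DepProd.app {A B D X : C} {g : A ⟶ B} {f : D ⟶ A} (P : DepProd g f)
    (k : X ⟶ P.obj) (x : X ⟶ A) (hx : k ≫ P.proj = x ≫ g) : X ⟶ D :=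
  P.pb.lift k x hx ≫ P.ev

theorem DepProd.app_comp {A B D X : C} {g : A ⟶ B} {f : D ⟶ A} (P : DepProd g f)
    (k : X ⟶ P.obj) (x : X ⟶ A) (hx : k ≫ P.proj = x ≫ g) : P.app k x hx ≫ f = x := by
  rw [DepProd.app, Category.assoc, P.ev_comp, PullbackData.lift_top]

theorem DepProd.app_lam {A B D X Y : C} {g : A ⟶ B} {f : D ⟶ A} (P : DepProd g f) (h : X ⟶ B)
    (Q : PullbackData h g) (w : Q.obj ⟶ D) (hw : w ≫ f = Q.top) (y : Y ⟶ Q.obj) (k : Y ⟶ P.obj)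
    (x : Y ⟶ A) (hk : k = y ≫ Q.proj ≫ P.lam h Q w hw) (hx : x = y ≫ Q.top)
    (e : k ≫ P.proj = x ≫ g) : P.app k x e = y ≫ w := by
  obtain ⟨hl, hw'⟩ := (P.universal h Q w hw).choose_spec.1
  rw [DepProd.app]
  conv_rhs => rw [← hw']
  rw [← Category.assoc]
  congr 1
  apply P.pb.hom_ext
  · rw [PullbackData.lift_proj, Category.assoc, PullbackData.lift_proj, hk]; rfl
  · rw [PullbackData.lift_top, Category.assoc, PullbackData.lift_top, hx]

/-- A path object of `f : X ⟶ B` in the slice over `B`, with respect to the class `F` of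
fibrations: a factorisation of the diagonal `X ⟶ X ×_B X` as an acyclic cofibration (a morphism
with the left lifting property with respect to all fibrations) followed by a fibration.
For the second factor `ends`, the two endpoints are `ends ≫ prod.proj` and `ends ≫ prod.top`. -/
structure PathData (F : MorphismProperty C) {X B : C} (f : X ⟶ B) where
  prod : PullbackData f f
  obj : C
  refl : X ⟶ obj
  ends : obj ⟶ prod.obj
  acyclic : F.llp refl
  fib : F ends
  fac : refl ≫ ends = prod.lift (𝟙 X) (𝟙 X) rfl

/-- `f` and `g` are right homotopic: `⟨f, g⟩ : X ⟶ Y × Y` lifts to a path object of `Y`, that is, a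
path object over the terminal object. -/
def RightHomotopic (F : MorphismProperty C) {X Y : C} (f g : X ⟶ Y) : Prop :=
  ∃ (T : C) (hT : IsTerminal T) (P : PathData F (hT.from Y)) (H : X ⟶ P.obj),
    H ≫ P.ends ≫ P.prod.proj = f ∧ H ≫ P.ends ≫ P.prod.top = g

/-- (Right) homotopy equivalences. -/
def IsHomotopyEquiv (F : MorphismProperty C) {X Y : C} (f : X ⟶ Y) : Prop :=
  ∃ g : Y ⟶ X, RightHomotopic F (g ≫ f) (𝟙 Y) ∧ RightHomotopic F (f ≫ g) (𝟙 X)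

variable {E U : C}

theorem comp_section {p : E ⟶ U} {Γ : C} {a : Γ ⟶ U} {c : U ⟶ Γ} (ha : c ≫ a = 𝟙 U) :
    (p ≫ c) ≫ a = 𝟙 E ≫ p := by
  rw [Category.assoc, ha, Category.comp_id, Category.id_comp]

theorem isPullback_section {p : E ⟶ U} {Γ : C} {a : Γ ⟶ U} {c : U ⟶ Γ} (ha : c ≫ a = 𝟙 U) :
    IsPullback p (𝟙 E) (c ≫ a) p := by
  rw [ha]; exact IsPullback.of_vert_isIso ⟨by simp⟩

/-- An interpretation, in a context `Γ`, of the function type `A → B`, where the types `A` and `B`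
in context `Γ` are the pullbacks of `p : E ⟶ U` along `a b : Γ ⟶ U`. It is `Π_{dom} cod`, where
`dom` is the type `A`, and `cod` is the type `B` in the context `Γ.A`. -/
structure FunData (p : E ⟶ U) {Γ : C} (a b : Γ ⟶ U) where
  dom : PullbackData a p
  cod : PullbackData (dom.proj ≫ b) p
  pi : DepProd dom.proj cod.proj

namespace FunData

variable {p : E ⟶ U} {Γ : C} {a b : Γ ⟶ U}

/-- The value in `B`, as an element of `E`, of the function `k` at the element `x : X ⟶ E` of
`A`. -/
noncomputable def app (M : FunData p a b) {X : C} (k : X ⟶ M.pi.obj) (x : X ⟶ E)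
    (hx : k ≫ M.pi.proj ≫ a = x ≫ p) : X ⟶ E :=
  M.pi.app k (M.dom.lift (k ≫ M.pi.proj) x (by simpa using hx))
    (by rw [PullbackData.lift_proj]) ≫ M.cod.top

theorem app_comp (M : FunData p a b) {X : C} (k : X ⟶ M.pi.obj) (x : X ⟶ E)
    (hx : k ≫ M.pi.proj ≫ a = x ≫ p) : M.app k x hx ≫ p = k ≫ M.pi.proj ≫ b := by
  rw [app, Category.assoc, ← M.cod.isPullback.w, ← Category.assoc, DepProd.app_comp,
    ← Category.assoc, PullbackData.lift_proj, Category.assoc]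

/-- For `c : U ⟶ Γ` such that `c ≫ a` and `c ≫ b` are the identity (`A` and `B` become the
universal type over `U`), the identity function in context `U`. -/
noncomputable def idFun (M : FunData p a b) (c : U ⟶ Γ) (ha : c ≫ a = 𝟙 U) (hb : c ≫ b = 𝟙 U) :
    U ⟶ M.pi.obj :=
  M.pi.lam c
    (M.dom.restrict c p (𝟙 E) (isPullback_section ha))
    (M.cod.lift (M.dom.lift (p ≫ c) (𝟙 E) (comp_section ha)) (𝟙 E)
      (by rw [← Category.assoc, PullbackData.lift_proj, Category.assoc, hb]; simp))
    (by rw [PullbackData.lift_proj])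

theorem idFun_proj (M : FunData p a b) (c : U ⟶ Γ) (ha : c ≫ a = 𝟙 U) (hb : c ≫ b = 𝟙 U) :
    M.idFun c ha hb ≫ M.pi.proj = c :=
  DepProd.lam_proj _ _ _ _ _

theorem app_idFun (M : FunData p a b) (c : U ⟶ Γ) (ha : c ≫ a = 𝟙 U) (hb : c ≫ b = 𝟙 U) {X : C}
    (k : X ⟶ M.pi.obj) (x : X ⟶ E) (hk : k = x ≫ p ≫ M.idFun c ha hb)
    (hx : k ≫ M.pi.proj ≫ a = x ≫ p) : M.app k x hx = x := by
  have h := M.pi.app_lam c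
    (M.dom.restrict c p (𝟙 E) (isPullback_section ha))
    (M.cod.lift (M.dom.lift (p ≫ c) (𝟙 E) (comp_section ha)) (𝟙 E)
      (by rw [← Category.assoc, PullbackData.lift_proj, Category.assoc, hb]; simp))
    (by rw [PullbackData.lift_proj]) x k
    (M.dom.lift (k ≫ M.pi.proj) x (by simpa using hx)) hk ?_ (by rw [PullbackData.lift_proj])
  · rw [app, h, Category.assoc, PullbackData.lift_top, Category.comp_id]
  apply M.dom.hom_ext
  · rw [PullbackData.lift_proj, hk, Category.assoc, Category.assoc, idFun_proj]
    simp only [PullbackData.restrict, Category.assoc, PullbackData.lift_proj]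
  · rw [PullbackData.lift_top]
    simp only [PullbackData.restrict, Category.assoc, PullbackData.lift_top, Category.comp_id]

end FunData

/-- An interpretation of the type `Π (x : A), Id_A (t x) x` in the context `Γ`, where `A` is the
pullback `dom` of `p` along `a : Γ ⟶ U`, the term `t x : A` in context `Γ.A` is given as
`t : dom.obj ⟶ E`, and identity types are interpreted by the path object `P` of `p` over `U`. -/
structure PiIdData {F : MorphismProperty C} {p : E ⟶ U} (P : PathData F p) {Γ : C} {a : Γ ⟶ U}
    (dom : PullbackData a p) (t : dom.obj ⟶ E) (ht : t ≫ p = dom.top ≫ p) where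
  idTy : PullbackData (P.prod.lift t dom.top ht) P.ends
  pi : DepProd dom.proj idTy.proj

/-- For `c : U ⟶ Γ` such that `c ≫ a` is the identity and `t` becomes the identity after
substitution along `c`, the term `x ↦ refl_x` of `Π (x : A), Id_A (t x) x` in context `U`. -/
noncomputable def PiIdData.reflFun {F : MorphismProperty C} {p : E ⟶ U} {P : PathData F p} {Γ : C}
    {a : Γ ⟶ U} {dom : PullbackData a p} {t : dom.obj ⟶ E} {ht : t ≫ p = dom.top ≫ p}
    (M : PiIdData P dom t ht) (c : U ⟶ Γ) (ha : c ≫ a = 𝟙 U)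
    (h : dom.lift (p ≫ c) (𝟙 E) (comp_section ha) ≫ t = 𝟙 E) : U ⟶ M.pi.obj :=
  M.pi.lam c
    (dom.restrict c p (𝟙 E) (isPullback_section ha))
    (M.idTy.lift (dom.lift (p ≫ c) (𝟙 E) (comp_section ha)) P.refl (by
      rw [P.fac]
      apply P.prod.hom_ext
      · rw [Category.assoc, PullbackData.lift_proj, PullbackData.lift_proj, h]
      · rw [Category.assoc, PullbackData.lift_top, PullbackData.lift_top,
          PullbackData.lift_top]))
    (by rw [PullbackData.lift_proj])

theorem PiIdData.reflFun_proj {F : MorphismProperty C} {p : E ⟶ U} {P : PathData F p} {Γ : C}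
    {a : Γ ⟶ U} {dom : PullbackData a p} {t : dom.obj ⟶ E} {ht : t ≫ p = dom.top ≫ p}
    (M : PiIdData P dom t ht) (c : U ⟶ Γ) (ha : c ≫ a = 𝟙 U)
    (h : dom.lift (p ≫ c) (𝟙 E) (comp_section ha) ≫ t = 𝟙 E) :
    M.reflFun c ha h ≫ M.pi.proj = c :=
  DepProd.lam_proj _ _ _ _ _

/-- The part of the interpretation of `Equiv(A, B)` in context `A B : Type` that concerns the
functions: `hom` is `A → B` in context `(A B : Type)`, and `back` is `B → A` in context
`(A B : Type) (f : A → B)`. -/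
structure FunctionsData (F : MorphismProperty C) (p : E ⟶ U) where
  base : C
  tyA : base ⟶ U
  tyB : base ⟶ U
  isProd : IsLimit (BinaryFan.mk tyA tyB)
  path : PathData F p
  hom : FunData p tyA tyB
  back : FunData p (hom.pi.proj ≫ tyB) (hom.pi.proj ≫ tyA)

namespace FunctionsData

variable {F : MorphismProperty C} {p : E ⟶ U} (M : FunctionsData F p)

/-- The context `(A B : Type) (f : A → B) (s : B → A)`. -/
abbrev ctx : C := M.back.pi.obj

/-- The type `A` in context `M.ctx`. -/
abbrev ctxA : M.ctx ⟶ U := M.back.pi.proj ≫ M.hom.pi.proj ≫ M.tyA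

/-- The type `B` in context `M.ctx`. -/
abbrev ctxB : M.ctx ⟶ U := M.back.pi.proj ≫ M.hom.pi.proj ≫ M.tyB

/-- The term `s b : A` in context `M.ctx, (b : B)`. -/
noncomputable def sb (domB : PullbackData M.ctxB p) : domB.obj ⟶ E :=
  M.back.app domB.proj domB.top (by simpa using domB.isPullback.w)

theorem sb_comp (domB : PullbackData M.ctxB p) : M.sb domB ≫ p = domB.proj ≫ M.ctxA := by
  rw [sb, FunData.app_comp]

/-- The term `f (s b) : B` in context `M.ctx, (b : B)`. -/
noncomputable def fsb (domB : PullbackData M.ctxB p) : domB.obj ⟶ E :=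
  M.hom.app (domB.proj ≫ M.back.pi.proj) (M.sb domB) (by rw [sb_comp]; simp)

theorem fsb_comp (domB : PullbackData M.ctxB p) : M.fsb domB ≫ p = domB.top ≫ p := by
  rw [fsb, FunData.app_comp, ← domB.isPullback.w]; simp

/-- The term `f a : B` in context `M.ctx, (a : A)`. -/
noncomputable def fa (domA : PullbackData M.ctxA p) : domA.obj ⟶ E :=
  M.hom.app (domA.proj ≫ M.back.pi.proj) domA.top (by simpa using domA.isPullback.w)

theorem fa_comp (domA : PullbackData M.ctxA p) : M.fa domA ≫ p = domA.proj ≫ M.ctxB := by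
  rw [fa, FunData.app_comp]; simp

/-- The term `s (f a) : A` in context `M.ctx, (a : A)`. -/
noncomputable def sfa (domA : PullbackData M.ctxA p) : domA.obj ⟶ E :=
  M.back.app domA.proj (M.fa domA) (by rw [fa_comp])

theorem sfa_comp (domA : PullbackData M.ctxA p) : M.sfa domA ≫ p = domA.top ≫ p := by
  rw [sfa, FunData.app_comp, ← domA.isPullback.w]

/-- The diagonal `U ⟶ U × U`. -/
noncomputable def diag : U ⟶ M.base := M.isProd.lift (BinaryFan.mk (𝟙 U) (𝟙 U))

theorem diag_tyA : M.diag ≫ M.tyA = 𝟙 U :=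
  M.isProd.fac (BinaryFan.mk (𝟙 U) (𝟙 U)) ⟨WalkingPair.left⟩

theorem diag_tyB : M.diag ≫ M.tyB = 𝟙 U :=
  M.isProd.fac (BinaryFan.mk (𝟙 U) (𝟙 U)) ⟨WalkingPair.right⟩

/-- `A ↦ (A, A, id)`. -/
noncomputable def idHom : U ⟶ M.hom.pi.obj := M.hom.idFun M.diag M.diag_tyA M.diag_tyB

theorem idHom_tyA : M.idHom ≫ M.hom.pi.proj ≫ M.tyA = 𝟙 U := by
  rw [idHom, ← Category.assoc, FunData.idFun_proj, diag_tyA]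

theorem idHom_tyB : M.idHom ≫ M.hom.pi.proj ≫ M.tyB = 𝟙 U := by
  rw [idHom, ← Category.assoc, FunData.idFun_proj, diag_tyB]

/-- `A ↦ (A, A, id, id)`. -/
noncomputable def idBack : U ⟶ M.ctx := M.back.idFun M.idHom M.idHom_tyB M.idHom_tyA

theorem idBack_proj : M.idBack ≫ M.back.pi.proj = M.idHom := FunData.idFun_proj _ _ _ _

theorem idBack_ctxA : M.idBack ≫ M.ctxA = 𝟙 U := by
  rw [← Category.assoc, idBack_proj, idHom_tyA]

theorem idBack_ctxB : M.idBack ≫ M.ctxB = 𝟙 U := by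
  rw [← Category.assoc, idBack_proj, idHom_tyB]

theorem comp_funApp {Γ : C} {a b : Γ ⟶ U} (N : FunData p a b) {X Y : C} (y : Y ⟶ X)
    (k : X ⟶ N.pi.obj) (x : X ⟶ E) (hx : k ≫ N.pi.proj ≫ a = x ≫ p) :
    y ≫ N.app k x hx = N.app (y ≫ k) (y ≫ x) (by simp [hx]) := by
  simp only [FunData.app, DepProd.app, ← Category.assoc]
  congr 2
  apply PullbackData.hom_ext
  · simp only [Category.assoc, PullbackData.lift_proj]
  · simp only [Category.assoc, PullbackData.lift_top]
    apply PullbackData.hom_ext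
    · simp only [Category.assoc, PullbackData.lift_proj]
    · simp only [Category.assoc, PullbackData.lift_top]

theorem funApp_congr {Γ : C} {a b : Γ ⟶ U} (N : FunData p a b) {X : C} {k : X ⟶ N.pi.obj}
    {x x' : X ⟶ E} (h : x = x') (hx : k ≫ N.pi.proj ≫ a = x ≫ p) :
    N.app k x hx = N.app k x' (h ▸ hx) := by
  subst h; rfl

theorem idBack_fsb (domB : PullbackData M.ctxB p) :
    domB.lift (p ≫ M.idBack) (𝟙 E) (comp_section M.idBack_ctxB) ≫ M.fsb domB
      = 𝟙 E := by
  have hs : domB.lift (p ≫ M.idBack) (𝟙 E) (comp_section M.idBack_ctxB) ≫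
      M.sb domB = 𝟙 E := by
    rw [sb, comp_funApp, funApp_congr _ (PullbackData.lift_top _ _ _ _)]
    apply FunData.app_idFun _ M.idHom M.idHom_tyB M.idHom_tyA
    rw [PullbackData.lift_proj, Category.id_comp]; rfl
  rw [fsb, comp_funApp, funApp_congr _ hs]
  apply FunData.app_idFun _ M.diag M.diag_tyA M.diag_tyB
  rw [← Category.assoc, PullbackData.lift_proj, Category.assoc, idBack_proj, Category.id_comp]
  rfl

theorem idBack_sfa (domA : PullbackData M.ctxA p) :
    domA.lift (p ≫ M.idBack) (𝟙 E) (comp_section M.idBack_ctxA) ≫ M.sfa domA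
      = 𝟙 E := by
  have hs : domA.lift (p ≫ M.idBack) (𝟙 E) (comp_section M.idBack_ctxA) ≫
      M.fa domA = 𝟙 E := by
    rw [fa, comp_funApp, funApp_congr _ (PullbackData.lift_top _ _ _ _)]
    apply FunData.app_idFun _ M.diag M.diag_tyA M.diag_tyB
    rw [← Category.assoc, PullbackData.lift_proj, Category.assoc, idBack_proj, Category.id_comp]
    rfl
  rw [sfa, comp_funApp, funApp_congr _ hs]
  apply FunData.app_idFun _ M.idHom M.idHom_tyB M.idHom_tyA
  rw [PullbackData.lift_proj, Category.id_comp]; rfl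

end FunctionsData

/-- An interpretation of the type
`Equiv(A, B) := Σ (f : A → B), (Σ (s : B → A), Π (b : B), f (s b) = b) ×
  (Σ (r : B → A), Π (a : A), r (f a) = a)`
in context `(A B : Type)`, where `Type` is `U` and its elements are read as types by means of
`p : E ⟶ U`. Dependent sums are compositions, the product of two types is the fibre product, function
types and dependent products are `Π`, identity types are path objects. -/
structure EquivData (F : MorphismProperty C) (p : E ⟶ U) extends FunctionsData F p where
  domB : PullbackData toFunctionsData.ctxB p
  rinv : PiIdData path domB (toFunctionsData.fsb domB) (toFunctionsData.fsb_comp domB)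
  domA : PullbackData toFunctionsData.ctxA p
  linv : PiIdData path domA (toFunctionsData.sfa domA) (toFunctionsData.sfa_comp domA)
  total : PullbackData (rinv.pi.proj ≫ back.pi.proj) (linv.pi.proj ≫ back.pi.proj)

namespace EquivData

variable {F : MorphismProperty C} {p : E ⟶ U} (I : EquivData F p)

/-- The space of equivalences: the domain of the fibration that interprets `Equiv(A, B)`. -/
abbrev space : C := I.total.obj

/-- `(A, B, e) ↦ (A, B, f)`, where `f : A → B` is the function underlying the equivalence `e`. -/
abbrev toHom : I.space ⟶ I.hom.pi.obj := I.total.proj ≫ I.rinv.pi.proj ≫ I.back.pi.proj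

/-- The fibration `Equiv(A, B)` over `U × U`. -/
abbrev toBase : I.space ⟶ I.base := I.toHom ≫ I.hom.pi.proj

/-- The morphism `U ⟶ E` over `U × U` that maps a type to its identity equivalence
`(A, A, id, (id, refl), (id, refl))`. -/
noncomputable def idEquiv : U ⟶ I.space :=
  I.total.lift
    (I.rinv.reflFun I.idBack I.idBack_ctxB (I.idBack_fsb I.domB))
    (I.linv.reflFun I.idBack I.idBack_ctxA (I.idBack_sfa I.domA))
    ((Category.assoc _ _ _).symm.trans
      ((congrArg (· ≫ I.back.pi.proj)
        ((I.rinv.reflFun_proj _ _ _).trans (I.linv.reflFun_proj _ _ _).symm)).trans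
        (Category.assoc _ _ _)))

end EquivData

/-- Univalence of `p : E ⟶ U`: the morphism from `U` to the space of equivalences that maps a type
to its identity equivalence is a (right) homotopy equivalence. -/
def IsUnivalent (F : MorphismProperty C) (p : E ⟶ U) : Prop :=
  ∃ I : EquivData F p, IsHomotopyEquiv F I.idEquiv

end TypeTheoreticNotions

universe w

/-- Groupoids equipped with an involution. -/
structure InvGpd where
  carrier : Type w
  [grpd : Groupoid.{w} carrier]
  inv : carrier ⥤ carrier
  inv_inv : inv ⋙ inv = 𝟭 carrier

attribute [instance] InvGpd.grpd

namespace InvGpd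

/-- Equivariant functors. -/
@[ext]
structure Hom (X Y : InvGpd.{w}) where
  functor : X.carrier ⥤ Y.carrier
  comm : X.inv ⋙ functor = functor ⋙ Y.inv

instance : Category InvGpd.{w} where
  Hom := Hom
  id X := ⟨𝟭 X.carrier, rfl⟩
  comp f g := ⟨f.functor ⋙ g.functor, by
    rw [← Functor.assoc, f.comm, Functor.assoc, g.comm, ← Functor.assoc]⟩

/-- The fixed points of the involution. -/
def Fix (X : InvGpd.{w}) : Type w := {x : X.carrier // X.inv.obj x = x}

/-- The action of an equivariant functor on objects. -/
def app {X Y : InvGpd.{w}} (f : X ⟶ Y) (x : X.carrier) : Y.carrier := (Hom.functor f).obj x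

/-- The map induced by an equivariant functor on fixed points. -/
def mapFix {X Y : InvGpd.{w}} (f : X ⟶ Y) (x : X.Fix) : Y.Fix :=
  ⟨app f x.1, by
    have h := congrArg (fun G => G.obj x.1) (Hom.comm f)
    exact h.symm.trans (congrArg (Hom.functor f).obj x.2)⟩

/-- The projective fibrations: the equivariant functors whose underlying functor is an
isofibration. -/
def projFib : MorphismProperty InvGpd.{w} := fun X Y f =>
  ∀ (x : X.carrier) (y : Y.carrier) (h : (Hom.functor f).obj x ⟶ y),
    ∃ (x' : X.carrier) (g : x ⟶ x') (e : (Hom.functor f).obj x' = y),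
      (Hom.functor f).map g ≫ eqToHom e = h

end InvGpd

/-- Objects of the universe `U_Δ`: triples `(A₀, A₁, φ)` of two `κ`-small discrete groupoids (i.e.
sets) and an isomorphism `φ : A₀ ≅ A₁`. -/
structure UObj (κ : Cardinal.{u}) : Type (u + 1) where
  fst : Type u
  snd : Type u
  small_fst : Cardinal.mk fst < κ
  small_snd : Cardinal.mk snd < κ
  equiv : fst ≃ snd

/-- Morphisms `(A₀, A₁, φ) ⟶ (B₀, B₁, ψ)` of `U_Δ`: pairs of isomorphisms `ρ₀ : A₀ ≅ B₀` and
`ρ₁ : A₁ ≅ B₁`, with a natural isomorphism (an equality, since `B₁` is discrete) between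
`ψ ∘ ρ₀` and `ρ₁ ∘ φ`. -/
@[ext]
structure UHom {κ : Cardinal.{u}} (X Y : UObj κ) : Type (u + 1) where
  fst : X.fst ≃ Y.fst
  snd : X.snd ≃ Y.snd
  comm : ∀ x, Y.equiv (fst x) = snd (X.equiv x)

instance (κ : Cardinal.{u}) : Groupoid.{u + 1} (UObj κ) where
  Hom := UHom
  id X := ⟨Equiv.refl _, Equiv.refl _, fun _ => rfl⟩
  comp f g := ⟨f.fst.trans g.fst, f.snd.trans g.snd, fun x => by simp [f.comm, g.comm]⟩
  inv {X Y} f := ⟨f.fst.symm, f.snd.symm, fun x => by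
    apply f.snd.injective; rw [← f.comm]; simp⟩
  inv_comp f := UHom.ext (by simp) (by simp)
  comp_inv f := UHom.ext (by simp) (by simp)

/-- Objects of `Ũ_Δ`: an object `(A₀, A₁, φ)` of `U_Δ` with an element `a` of `A₀`. -/
structure PtUObj (κ : Cardinal.{u}) : Type (u + 1) extends UObj κ where
  pt : fst

/-- Morphisms of `Ũ_Δ`: morphisms of `U_Δ` with an isomorphism (an equality, since `B₀` is discrete)
between `ρ₀ a` and `b`. -/
@[ext]
structure PtUHom {κ : Cardinal.{u}} (X Y : PtUObj κ) : Type (u + 1) extends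
    UHom X.toUObj Y.toUObj where
  map_pt : fst X.pt = Y.pt

instance (κ : Cardinal.{u}) : Groupoid.{u + 1} (PtUObj κ) where
  Hom := PtUHom
  id X := ⟨⟨Equiv.refl _, Equiv.refl _, fun _ => rfl⟩, rfl⟩
  comp f g := ⟨⟨f.fst.trans g.fst, f.snd.trans g.snd, fun x => by simp [f.comm, g.comm]⟩,
    by simp [f.map_pt, g.map_pt]⟩
  inv {X Y} f := ⟨⟨f.fst.symm, f.snd.symm, fun x => by
    apply f.snd.injective; rw [← f.comm]; simp⟩, by simp [← f.map_pt]⟩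
  inv_comp f := PtUHom.ext (by simp) (by simp)
  comp_inv f := PtUHom.ext (by simp) (by simp)

/-- The functor `(A₀, A₁, a, φ) ↦ (A₀, A₁, φ)`. -/
def forgetPt (κ : Cardinal.{u}) : PtUObj κ ⥤ UObj κ where
  obj X := X.toUObj
  map f := PtUHom.toUHom f

/-- `U_Δ`, with the involution `(A₀, A₁, φ) ↦ (A₁, A₀, φ⁻¹)`, `(ρ₀, ρ₁) ↦ (ρ₁, ρ₀)`. -/
def UΔ (κ : Cardinal.{u}) : InvGpd.{u + 1} where
  carrier := UObj κ
  inv :=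
    { obj := fun X => ⟨X.snd, X.fst, X.small_snd, X.small_fst, X.equiv.symm⟩
      map := fun {X Y} f => ⟨f.snd, f.fst, fun x => by
        apply Y.equiv.injective; rw [f.comm]; simp⟩ }
  inv_inv := rfl

/-- `Ũ_Δ`, with the involution `(A₀, A₁, a, φ) ↦ (A₁, A₀, φ a, φ⁻¹)`,
`(ρ₀, ρ₁) ↦ (ρ₁, ρ₀)`. -/
def PtUΔ (κ : Cardinal.{u}) : InvGpd.{u + 1} where
  carrier := PtUObj κ
  inv :=
    { obj := fun X => ⟨(UΔ κ).inv.obj X.toUObj, X.equiv X.pt⟩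
      map := fun {X Y} f => PtUHom.mk ((UΔ κ).inv.map ((forgetPt κ).map f)) (by
        change f.snd (X.equiv X.pt) = Y.equiv Y.pt
        rw [← f.comm, f.map_pt]) }
  inv_inv := by
    have hobj : ∀ X : PtUObj κ,
        (⟨X.toUObj, X.equiv.symm (X.equiv X.pt)⟩ : PtUObj κ) = X := fun X => by simp
    have : (forgetPt κ).Faithful := ⟨fun {X Y f g} h =>
      PtUHom.ext (congrArg UHom.fst h) (congrArg UHom.snd h)⟩
    refine CategoryTheory.Functor.ext hobj (fun X Y f => (forgetPt κ).map_injective ?_)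
    have key : ∀ {A B : PtUObj κ} (e : A = B),
        (forgetPt κ).map (eqToHom e) = eqToHom (congrArg (forgetPt κ).obj e) := by
      intro A B e; subst e; rfl
    rw [Functor.map_comp, Functor.map_comp]
    refine Eq.trans ?_ (congrArg₂ (fun a b => a ≫ (forgetPt κ).map f ≫ b)
      (key (hobj X)) (key (hobj Y).symm)).symm
    exact UHom.ext rfl rfl

/-- The universe `p_Δ : Ũ_Δ ⟶ U_Δ`. -/
def pΔ (κ : Cardinal.{u}) : PtUΔ κ ⟶ UΔ κ where
  functor := forgetPt κ
  comm := rfl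

/-- The object `(ℤ, ℤ, id)` of `U_Δ`. -/
def intObj (κ : Cardinal.{u}) (hκ : κ.IsInaccessible) : UObj κ where
  fst := ULift.{u} ℤ
  snd := ULift.{u} ℤ
  small_fst := by simpa using hκ.aleph0_lt
  small_snd := by simpa using hκ.aleph0_lt
  equiv := Equiv.refl _

/-- The object `(ℤ, ℤ, n, id)` of `Ũ_Δ`. -/
def ptIntObj (κ : Cardinal.{u}) (hκ : κ.IsInaccessible) (n : ℤ) : PtUObj κ where
  toUObj := intObj κ hκ
  pt := ULift.up n

/-- The function underlying the equivalence `e` (a point of the space of equivalences) maps `x` to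
`y`, where `x` and `y` are objects of `Ũ_Δ`: there is an object `(f, x)` of the pullback on which the
evaluation of functions is defined, such that `f` underlies `e` and the value of `f` at `x` is
`y`. -/
def EquivData.SendsTo {κ : Cardinal.{u}} (I : EquivData InvGpd.projFib (pΔ κ))
    (e : I.space.carrier) (x y : PtUObj κ) : Prop :=
  ∃ q : I.hom.pi.pb.obj.carrier,
    InvGpd.app I.hom.pi.pb.proj q = InvGpd.app I.toHom e ∧
    InvGpd.app (I.hom.pi.pb.top ≫ I.hom.dom.top) q = x ∧
    InvGpd.app (I.hom.pi.ev ≫ I.hom.cod.top) q = y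

/-! ### Lifts of morphisms along faithful functors, and discrete fibrations. -/

section Functors

variable {A B D Z : Type*} [Category A] [Category B] [Category D] [Category Z]

/-! Fixed points of the involution detect the failure of univalence. A projective fibration is a
condition on the underlying functor only, so a free orbit may be attached freely: any `r : Y ⟶ P`
factors through a fibration over `P` obtained from `Y` by adding, over every object of `P`, two
points that the involution exchanges. All fixed points of the result come from `Y`. If `r` is an
acyclic cofibration, lifting the identity of `P` against this fibration shows that `r` is surjective
on fixed points (`mapFix_surjective_of_llp`). Hence every fixed point of a path object is a
reflexivity, right homotopic morphisms agree on fixed points (`app_eq_of_rightHomotopic`), and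
homotopy equivalences are surjective on fixed points.

The identity equivalence is not. A fixed point is a morphism from the point with trivial involution,
that is, a closed term. In any category, a strictly invertible automorphism of a type yields a term
of `Equiv`: the inverse serves as both `s` and `r`, and both homotopies are reflexivities
(`EquivData.exists_of_automorphism`). Negation of the integers gives such a closed term. A fixed
point of `U_Δ` gives an identity function, and `-1 ≠ 1`. Only universal properties enter, so the
argument covers every interpretation.

Existence of an interpretation rests on `p_Δ` being a discrete fibration. Pullbacks and dependent
products of discrete fibrations are built explicitly, and the diagonal of a discrete fibration is
again one, so the identity followed by the diagonal is a path object. -/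

theorem CategoryTheory.Functor.IsHomLift.map_of_comm {A' B' : Type*} [Category A'] [Category B']
    {F : A ⥤ A'} {F' : B ⥤ B'} {g : A ⥤ B} {g' : A' ⥤ B'} (h : F ⋙ g' = g ⋙ F')
    {a a' : A} {b b' : B} {β : b ⟶ b'} {α : a ⟶ a'} (hα : g.IsHomLift β α) :
    g'.IsHomLift (F'.map β) (F.map α) := by
  obtain ⟨⟩ := hα
  exact IsHomLift.of_fac _ _ _ (Functor.congr_obj h _) (Functor.congr_obj h _)
    (Functor.congr_hom h.symm _)

theorem CategoryTheory.Functor.IsHomLift.source_eq {p : D ⥤ A} {d d' : D} {a a' : A} {α : a ⟶ a'}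
    {δ : d ⟶ d'} (h : p.IsHomLift α δ) : p.obj d = a := IsHomLift.domain_eq p α δ

theorem CategoryTheory.Functor.IsHomLift.target_eq {p : D ⥤ A} {d d' : D} {a a' : A} {α : a ⟶ a'}
    {δ : d ⟶ d'} (h : p.IsHomLift α δ) : p.obj d' = a' := IsHomLift.codomain_eq p α δ

theorem CategoryTheory.Functor.IsHomLift.comp_functor {p : D ⥤ A} {g : A ⥤ B} {d d' : D} {a a' : A}
    {b b' : B} {δ : d ⟶ d'} {α : a ⟶ a'} {β : b ⟶ b'} (h : p.IsHomLift α δ)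
    (h' : g.IsHomLift β α) : (p ⋙ g).IsHomLift β δ := by
  obtain ⟨⟩ := h
  obtain ⟨⟩ := h'
  exact Functor.IsHomLift.map (p := p ⋙ g) δ

theorem CategoryTheory.Functor.IsHomLift.map_comp_functor {p : D ⥤ A} {g : A ⥤ B} {d d' : D}
    {b b' : B} {δ : d ⟶ d'} {β : b ⟶ b'} (h : (p ⋙ g).IsHomLift β δ) :
    g.IsHomLift β (p.map δ) := by
  obtain ⟨⟩ := h
  exact Functor.IsHomLift.map (p := g) (p.map δ)

/-- Functors into the domain of a faithful functor are equal if they agree on objects and after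
composition. -/
theorem CategoryTheory.Functor.ext_of_faithful_comp (p : D ⥤ A) [p.Faithful] {F G : Z ⥤ D}
    (h : F ⋙ p = G ⋙ p) (hobj : ∀ z, F.obj z = G.obj z) : F = G := by
  refine Functor.ext hobj fun z z' ζ => p.map_injective ?_
  rw [p.map_comp, p.map_comp, eqToHom_map, eqToHom_map]
  exact Functor.congr_hom h ζ

/-- The lift of a functor `F` along a faithful functor `p` with prescribed values on objects. -/
noncomputable def CategoryTheory.Functor.liftFaithful (p : D ⥤ A) [p.Faithful] (F : Z ⥤ A)
    (o : Z → D) (ho : ∀ z, p.obj (o z) = F.obj z)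
    (hm : ∀ ⦃z z' : Z⦄ (ζ : z ⟶ z'), ∃ δ : o z ⟶ o z', p.IsHomLift (F.map ζ) δ) : Z ⥤ D where
  obj := o
  map ζ := (hm ζ).choose
  map_id z := p.map_injective (by
    have h := (hm (𝟙 z)).choose_spec
    exact (IsHomLift.fac' p (F.map (𝟙 z)) (hm (𝟙 z)).choose).trans (by simp))
  map_comp ζ ξ := p.map_injective (by
    have h₁ := (hm ζ).choose_spec
    have h₂ := (hm ξ).choose_spec
    have h₃ := (hm (ζ ≫ ξ)).choose_spec
    rw [p.map_comp, IsHomLift.fac' p (F.map ζ) (hm ζ).choose,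
      IsHomLift.fac' p (F.map ξ) (hm ξ).choose,
      IsHomLift.fac' p (F.map (ζ ≫ ξ)) (hm (ζ ≫ ξ)).choose]; simp)

theorem CategoryTheory.Functor.liftFaithful_comp (p : D ⥤ A) [p.Faithful] (F : Z ⥤ A)
    (o : Z → D) (ho : ∀ z, p.obj (o z) = F.obj z)
    (hm : ∀ ⦃z z' : Z⦄ (ζ : z ⟶ z'), ∃ δ : o z ⟶ o z', p.IsHomLift (F.map ζ) δ) :
    p.liftFaithful F o ho hm ⋙ p = F := by
  refine Functor.ext ho fun z z' ζ => ?_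
  have := (hm ζ).choose_spec
  exact IsHomLift.fac' p (F.map ζ) (hm ζ).choose

/-- Discrete fibrations, between groupoids: faithful functors such that every morphism whose source
is in the image has a lift, and such that lifts of identities are endomorphisms. -/
structure IsDiscFib (p : D ⥤ A) : Prop where
  faithful : p.Faithful
  exists_lift : ∀ (d : D) {a a' : A} (α : a ⟶ a'), p.obj d = a →
    ∃ (d' : D) (δ : d ⟶ d'), p.IsHomLift α δ
  eq_of_lift_id : ∀ {d d' : D} {a : A} (δ : d ⟶ d'), p.IsHomLift (𝟙 a) δ → d = d'

end Functors

theorem CategoryTheory.Functor.IsHomLift.inverse {D A : Type*} [Groupoid D] [Groupoid A]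
    {p : D ⥤ A} {d d' : D} {a a' : A} {α : a ⟶ a'} {δ : d ⟶ d'} (h : p.IsHomLift α δ) :
    p.IsHomLift (CategoryTheory.inv α) (CategoryTheory.inv δ) := inferInstance

/-- The morphism `inv δ₁ ≫ δ₂` lies over an identity, so its ends coincide. -/
theorem IsDiscFib.target_unique {D : Type*} {A : Type*} [Groupoid D] [Groupoid A] {p : D ⥤ A}
    (hp : IsDiscFib p) {d d₁ d₂ : D} {a a' : A} {α : a ⟶ a'} {δ₁ : d ⟶ d₁} {δ₂ : d ⟶ d₂}
    (h₁ : p.IsHomLift α δ₁) (h₂ : p.IsHomLift α δ₂) : d₁ = d₂ := by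
  refine hp.eq_of_lift_id (a := a') (inv δ₁ ≫ δ₂) ?_
  have : p.IsHomLift (inv α) (inv δ₁) := inferInstance
  rw [← IsIso.inv_hom_id α]
  infer_instance

theorem IsDiscFib.comp {D A B : Type*} [Category D] [Category A] [Category B] {p : D ⥤ A}
    {g : A ⥤ B} (hp : IsDiscFib p) (hg : IsDiscFib g) : IsDiscFib (p ⋙ g) where
  faithful := by
    have := hp.faithful
    have := hg.faithful
    infer_instance
  exists_lift d b b' β h := by
    obtain ⟨a', α, hα⟩ := hg.exists_lift (p.obj d) β h
    obtain ⟨d', δ, hδ⟩ := hp.exists_lift d α rfl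
    exact ⟨d', δ, hδ.comp_functor hα⟩
  eq_of_lift_id {d d' b} δ h := by
    have e := hg.eq_of_lift_id _ h.map_comp_functor
    have : g.IsHomLift (𝟙 b) (p.map δ) := h.map_comp_functor
    have := hg.faithful
    -- Since `g` is faithful, `p.map δ`, which lies over an identity, is itself an identity up to
    -- transport.
    refine hp.eq_of_lift_id (a := p.obj d) δ (IsHomLift.of_fac _ _ _ rfl e.symm ?_)
    apply g.map_injective
    simp [eqToHom_map, IsHomLift.fac' g (𝟙 b) (p.map δ)]

/-! ### Faithful equivariant functors, a pullback criterion, and total groupoids of families. -/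

namespace InvGpd

variable {X Y Z A B D : InvGpd.{w}}

theorem hom_ext {f g : X ⟶ Y} (h : Hom.functor f = Hom.functor g) : f = g := Hom.ext h

theorem inv_inv_obj (X : InvGpd.{w}) (x : X.carrier) : X.inv.obj (X.inv.obj x) = x :=
  Functor.congr_obj X.inv_inv x

theorem app_inv (f : X ⟶ Y) (x : X.carrier) : app f (X.inv.obj x) = Y.inv.obj (app f x) :=
  Functor.congr_obj (Hom.comm f) x

theorem app_comp (f : X ⟶ Y) (g : Y ⟶ Z) (x : X.carrier) : app (f ≫ g) x = app g (app f x) := rfl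

theorem app_congr {f g : X ⟶ Y} (h : f = g) (x : X.carrier) : app f x = app g x := by rw [h]

theorem ext_of_faithful (p : D ⟶ A) (hp : (Hom.functor p).Faithful) {f g : Z ⟶ D}
    (h : f ≫ p = g ≫ p) (hobj : ∀ z, app f z = app g z) : f = g :=
  hom_ext (Functor.ext_of_faithful_comp (Hom.functor p) (congrArg Hom.functor h) hobj)

theorem isHomLift_inv (f : X ⟶ Y) {x x' : X.carrier} {y y' : Y.carrier} {ξ : x ⟶ x'} {η : y ⟶ y'}
    (h : (Hom.functor f).IsHomLift η ξ) :
    (Hom.functor f).IsHomLift (Y.inv.map η) (X.inv.map ξ) :=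
  Functor.IsHomLift.map_of_comm (Hom.comm f) h

/-- The lift of an equivariant functor `F` along a faithful one with prescribed values on
objects. -/
noncomputable def liftFaithful (p : D ⟶ A) (hp : (Hom.functor p).Faithful) (F : Z ⟶ A)
    (o : Z.carrier → D.carrier) (ho : ∀ z, app p (o z) = app F z)
    (hm : ∀ ⦃z z' : Z.carrier⦄ (ζ : z ⟶ z'),
      ∃ δ : o z ⟶ o z', (Hom.functor p).IsHomLift ((Hom.functor F).map ζ) δ)
    (hi : ∀ z, o (Z.inv.obj z) = D.inv.obj (o z)) : Z ⟶ D where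
  functor := (Hom.functor p).liftFaithful (Hom.functor F) o ho hm
  comm := by
    refine Functor.ext_of_faithful_comp (Hom.functor p) ?_ hi
    have h := Functor.liftFaithful_comp (Hom.functor p) (Hom.functor F) o ho hm
    refine (congrArg (Z.inv ⋙ ·) h).trans ((Hom.comm F).trans ?_)
    exact (congrArg (· ⋙ A.inv) h.symm).trans
      (congrArg ((Hom.functor p).liftFaithful (Hom.functor F) o ho hm ⋙ ·) (Hom.comm p).symm)

theorem liftFaithful_comp (p : D ⟶ A) (hp : (Hom.functor p).Faithful) (F : Z ⟶ A)
    (o : Z.carrier → D.carrier) (ho : ∀ z, app p (o z) = app F z)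
    (hm : ∀ ⦃z z' : Z.carrier⦄ (ζ : z ⟶ z'),
      ∃ δ : o z ⟶ o z', (Hom.functor p).IsHomLift ((Hom.functor F).map ζ) δ)
    (hi : ∀ z, o (Z.inv.obj z) = D.inv.obj (o z)) : liftFaithful p hp F o ho hm hi ≫ p = F :=
  hom_ext (Functor.liftFaithful_comp (Hom.functor p) (Hom.functor F) o ho hm)

/-- A criterion for a square whose vertical morphisms are faithful to be a pullback. -/
theorem isPullback_of_faithful {q : Z ⟶ X} {t : Z ⟶ A} {h : X ⟶ B} {g : A ⟶ B}
    (w : q ≫ h = t ≫ g) (hq : (Hom.functor q).Faithful) (hg : (Hom.functor g).Faithful)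
    (ex : ∀ x a, app h x = app g a → ∃ z, app q z = x ∧ app t z = a)
    (uniq : ∀ z z', app q z = app q z' → app t z = app t z' → z = z')
    (lift : ∀ (z z' : Z.carrier) (ξ : (Hom.functor q).obj z ⟶ (Hom.functor q).obj z')
      (α : (Hom.functor t).obj z ⟶ (Hom.functor t).obj z'),
      (Hom.functor g).IsHomLift ((Hom.functor h).map ξ) α →
      ∃ ζ : z ⟶ z', (Hom.functor q).map ζ = ξ) : IsPullback q t h g := by
  have key : ∀ {Y : InvGpd.{w}} (a : Y ⟶ X) (b : Y ⟶ A), a ≫ h = b ≫ g →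
      ∃ l : Y ⟶ Z, l ≫ q = a ∧ l ≫ t = b := by
    intro Y a b hab
    choose o ho₁ ho₂ using fun y => ex (app a y) (app b y) (app_congr hab y)
    have hm : ∀ ⦃z z' : Y.carrier⦄ (ζ : z ⟶ z'),
        ∃ δ : o z ⟶ o z', (Hom.functor q).IsHomLift ((Hom.functor a).map ζ) δ := by
      intro z z' ζ
      have e₁ : ∀ y, (Hom.functor q).obj (o y) = (Hom.functor a).obj y := ho₁
      have e₂ : ∀ y, (Hom.functor t).obj (o y) = (Hom.functor b).obj y := ho₂
      -- The morphisms `a ζ` and `b ζ` are conjugated by the equalities of objects, so that their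
      -- ends become the projections of `o z` and `o z'`.
      obtain ⟨δ, hδ⟩ := lift (o z) (o z')
        (eqToHom (e₁ z) ≫ (Hom.functor a).map ζ ≫ eqToHom (e₁ z').symm)
        (eqToHom (e₂ z) ≫ (Hom.functor b).map ζ ≫ eqToHom (e₂ z').symm) (by
          rw [Functor.map_comp, Functor.map_comp, eqToHom_map, eqToHom_map,
            IsHomLift.comp_eqToHom_lift_iff, IsHomLift.eqToHom_comp_lift_iff,
            IsHomLift.lift_eqToHom_comp_iff, IsHomLift.lift_comp_eqToHom_iff]
          exact IsHomLift.of_fac (Hom.functor g) _ _ (app_congr hab z).symm (app_congr hab z').symm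
            (Functor.congr_hom (congrArg Hom.functor hab) ζ))
      exact ⟨δ, IsHomLift.of_fac' _ _ _ (ho₁ z) (ho₁ z') hδ⟩
    refine ⟨liftFaithful q hq a o ho₁ hm fun z => ?_, liftFaithful_comp _ _ _ _ _ _ _, ?_⟩
    -- The values of `o` are chosen object by object; equivariance holds because an object of `Z` is
    -- determined by its two projections.
    · apply uniq
      · rw [app_inv, ho₁, ho₁, app_inv]
      · rw [app_inv, ho₂, ho₂, app_inv]
    -- The action of `t` on morphisms needs no check: both sides agree after composition with the
    -- faithful `g`.
    · apply ext_of_faithful g hg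
      · rw [Category.assoc, ← w, ← Category.assoc, liftFaithful_comp, hab]
      · exact ho₂
  refine ⟨⟨w⟩, ⟨PullbackCone.IsLimit.mk w (fun s => (key s.fst s.snd s.condition).choose)
    (fun s => (key s.fst s.snd s.condition).choose_spec.1)
    (fun s => (key s.fst s.snd s.condition).choose_spec.2) fun s m h₁ h₂ => ?_⟩⟩
  obtain ⟨e₁, e₂⟩ := (key s.fst s.snd s.condition).choose_spec
  apply ext_of_faithful q hq (h₁.trans e₁.symm)
  exact fun y => uniq _ _ (app_congr (h₁.trans e₁.symm) y) (app_congr (h₂.trans e₂.symm) y)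

/-- Families of fibres and sets of transports that determine a faithful functor to `B`. -/
structure Displayed (B : InvGpd.{w}) where
  fib : B.carrier → Type w
  rel : ∀ {b b' : B.carrier}, (b ⟶ b') → fib b → fib b' → Prop
  rel_id : ∀ {b} (t : fib b), rel (𝟙 b) t t
  rel_comp : ∀ {b b' b''} (β : b ⟶ b') (β' : b' ⟶ b'') {t t' t''},
    rel β t t' → rel β' t' t'' → rel (β ≫ β') t t''
  rel_inv : ∀ {b b'} (β : b ⟶ b') {t t'}, rel β t t' → rel (Groupoid.inv β) t' t
  invol : ∀ {b}, fib b → fib (B.inv.obj b)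
  rel_invol : ∀ {b b'} (β : b ⟶ b') {t t'}, rel β t t' → rel (B.inv.map β) (invol t) (invol t')
  invol_invol : ∀ {b} (t : fib b), invol (invol t) ≍ t

namespace Displayed

/-- The objects of the total groupoid. -/
structure Obj (T : Displayed B) : Type w where
  base : B.carrier
  elt : T.fib base

theorem Obj.ext' {T : Displayed B} {x y : T.Obj} (h : x.base = y.base) (h' : x.elt ≍ y.elt) :
    x = y := by
  obtain ⟨b, t⟩ := x
  obtain ⟨b', t'⟩ := y
  obtain rfl : b = b' := h
  obtain rfl := eq_of_heq h'
  rfl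

instance (T : Displayed B) : Groupoid T.Obj where
  Hom x y := {β : x.base ⟶ y.base // T.rel β x.elt y.elt}
  id _ := ⟨𝟙 _, T.rel_id _⟩
  comp f g := ⟨f.1 ≫ g.1, T.rel_comp _ _ f.2 g.2⟩
  inv f := ⟨Groupoid.inv f.1, T.rel_inv _ f.2⟩
  inv_comp _ := Subtype.ext (Groupoid.inv_comp _)
  comp_inv _ := Subtype.ext (Groupoid.comp_inv _)
  id_comp _ := Subtype.ext (Category.id_comp _)
  comp_id _ := Subtype.ext (Category.comp_id _)
  assoc _ _ _ := Subtype.ext (Category.assoc _ _ _)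

/-- The projection to the base. -/
def forget (T : Displayed B) : T.Obj ⥤ B.carrier where
  obj x := x.base
  map f := f.1

instance (T : Displayed B) : T.forget.Faithful := ⟨fun h => Subtype.ext h⟩

/-- The involution of the total groupoid. -/
def totalInv (T : Displayed B) : T.Obj ⥤ T.Obj where
  obj x := ⟨B.inv.obj x.base, T.invol x.elt⟩
  map f := ⟨B.inv.map f.1, T.rel_invol _ f.2⟩
  map_id _ := Subtype.ext (B.inv.map_id _)
  map_comp _ _ := Subtype.ext (B.inv.map_comp _ _)

/-- The total groupoid. -/
def total (T : Displayed B) : InvGpd.{w} where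
  carrier := T.Obj
  inv := T.totalInv
  inv_inv := Functor.ext_of_faithful_comp T.forget
    (by
      change T.forget ⋙ B.inv ⋙ B.inv = _
      rw [B.inv_inv]; rfl)
    fun x => Obj.ext' (B.inv_inv_obj x.base) (T.invol_invol x.elt)

/-- The projection of the total groupoid to the base. -/
def proj (T : Displayed B) : T.total ⟶ B where
  functor := T.forget
  comm := rfl

theorem proj_faithful (T : Displayed B) : (Hom.functor T.proj).Faithful :=
  inferInstanceAs T.forget.Faithful

/-- A morphism of the total groupoid. -/
def homMk (T : Displayed B) {x y : T.total.carrier} (β : app T.proj x ⟶ app T.proj y)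
    (h : T.rel β (Obj.elt x) (Obj.elt y)) : x ⟶ y := ⟨β, h⟩

theorem isHomLift_homMk (T : Displayed B) {x y : T.total.carrier}
    (β : app T.proj x ⟶ app T.proj y) (h : T.rel β (Obj.elt x) (Obj.elt y)) :
    (Hom.functor T.proj).IsHomLift β (T.homMk β h) :=
  Functor.IsHomLift.map (p := Hom.functor T.proj) (T.homMk β h)

end Displayed

end InvGpd

namespace InvGpd

variable {X Y Z A B D E : InvGpd.{w}}

theorem map_inv (f : X ⟶ Y) {x x' : X.carrier} (ξ : x ⟶ x') :
    (Hom.functor f).map (X.inv.map ξ) = eqToHom (app_inv f x) ≫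
      Y.inv.map ((Hom.functor f).map ξ) ≫ eqToHom (app_inv f x').symm :=
  Functor.congr_hom (Hom.comm f) ξ

theorem Displayed.isDiscFib_proj (T : Displayed B)
    (ex : ∀ {b b' : B.carrier} (β : b ⟶ b') (t : T.fib b), ∃ t', T.rel β t t')
    (uniq : ∀ {b : B.carrier} (t t' : T.fib b), T.rel (𝟙 b) t t' → t = t') :
    IsDiscFib (Hom.functor T.proj) where
  faithful := T.proj_faithful
  exists_lift := by
    rintro ⟨b, t⟩ _ b' β rfl
    obtain ⟨t', ht⟩ := ex β t
    exact ⟨⟨b', t'⟩, _, T.isHomLift_homMk (x := ⟨b, t⟩) (y := ⟨b', t'⟩) β ht⟩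
  eq_of_lift_id {x y b} δ hδ := by
    obtain ⟨b₁, t⟩ := x
    obtain ⟨b₂, t'⟩ := y
    obtain rfl : b₁ = b := IsHomLift.domain_eq (Hom.functor T.proj) (𝟙 b) δ
    obtain rfl : b₂ = b₁ := IsHomLift.codomain_eq (Hom.functor T.proj) (𝟙 b₁) δ
    have e : 𝟙 b₂ = (Hom.functor T.proj).map δ :=
      @IsHomLift.eq_of_isHomLift _ _ _ _ (Hom.functor T.proj) ⟨b₂, t⟩ ⟨b₂, t'⟩ (𝟙 b₂) δ hδ
    have h : T.rel ((Hom.functor T.proj).map δ) t t' := Subtype.property δ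
    rw [← e] at h
    rw [uniq t t' h]

/-! ### Explicit pullbacks of faithful morphisms, and transfer to arbitrary pullbacks. -/

section Pullback

/-- The fibres of the pullback of a morphism `g` along `h`. -/
def pullbackDisplayed (h : X ⟶ B) (g : A ⟶ B) : Displayed X where
  fib x := {a : A.carrier // app h x = app g a}
  rel ξ a a' := ∃ α : a.1 ⟶ a'.1, (Hom.functor g).IsHomLift ((Hom.functor h).map ξ) α
  rel_id {x} a := ⟨𝟙 a.1, by
    rw [CategoryTheory.Functor.map_id]; exact IsHomLift.id a.2.symm⟩
  rel_comp ξ ξ' := fun ⟨α, hα⟩ ⟨α', hα'⟩ =>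
    ⟨α ≫ α', by rw [CategoryTheory.Functor.map_comp]; infer_instance⟩
  rel_inv ξ := fun ⟨α, hα⟩ => ⟨CategoryTheory.inv α, by
    rw [Groupoid.inv_eq_inv, CategoryTheory.Functor.map_inv]; infer_instance⟩
  invol {x} a := ⟨A.inv.obj a.1, by
    rw [app_inv, app_inv]; exact congrArg B.inv.obj a.2⟩
  rel_invol ξ := fun ⟨α, hα⟩ => ⟨A.inv.map α, by
    have := isHomLift_inv g hα
    rw [InvGpd.map_inv]
    exact (IsHomLift.lift_eqToHom_comp_iff ..).2 ((IsHomLift.lift_comp_eqToHom_iff ..).2 this)⟩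
  invol_invol {x} a := by
    -- The two elements live in fibres over `X.inv.obj (X.inv.obj x)` and `x`; once the membership
    -- proofs are abstracted, both base and element can be rewritten.
    have e := A.inv_inv_obj a.1
    have e' := X.inv_inv_obj x
    generalize_proofs p₁ p₂
    revert p₂
    rw [e, e']
    exact fun _ => HEq.rfl

/-- The projection of the pullback of a faithful morphism to the domain of that morphism. -/
noncomputable def pullbackTop (h : X ⟶ B) (g : A ⟶ B) (hg : (Hom.functor g).Faithful) :
    (pullbackDisplayed h g).total ⟶ A :=
  liftFaithful g hg ((pullbackDisplayed h g).proj ≫ h)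
    (fun z => (Displayed.Obj.elt z).1) (fun z => (Displayed.Obj.elt z).2.symm)
    (fun _ _ ζ => Subtype.property ζ) (fun z => rfl)

theorem pullbackTop_comp (h : X ⟶ B) (g : A ⟶ B) (hg : (Hom.functor g).Faithful) :
    pullbackTop h g hg ≫ g = (pullbackDisplayed h g).proj ≫ h :=
  liftFaithful_comp g hg _ _ _ (fun _ _ ζ => Subtype.property ζ) _

/-- The pullback of a faithful morphism. -/
noncomputable def pullbackData (h : X ⟶ B) (g : A ⟶ B) (hg : (Hom.functor g).Faithful) :
    PullbackData h g where
  obj := (pullbackDisplayed h g).total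
  proj := (pullbackDisplayed h g).proj
  top := pullbackTop h g hg
  isPullback := isPullback_of_faithful (pullbackTop_comp h g hg).symm
    (Displayed.proj_faithful _) hg (fun x a e => ⟨⟨x, ⟨a, e⟩⟩, rfl, rfl⟩)
    (by
      rintro ⟨x, a, e⟩ ⟨x', a', e'⟩ (rfl : x = x') (rfl : a = a')
      rfl)
    fun z z' ξ α hα => ⟨Displayed.homMk _ ξ ⟨α, hα⟩, rfl⟩

theorem pullbackData_ext {h : X ⟶ B} {g : A ⟶ B} {hg : (Hom.functor g).Faithful}
    {z z' : (pullbackData h g hg).obj.carrier}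
    (e : app (pullbackData h g hg).proj z = app (pullbackData h g hg).proj z')
    (e' : app (pullbackData h g hg).top z = app (pullbackData h g hg).top z') : z = z' := by
  obtain ⟨x, a, e₁⟩ := z
  obtain ⟨x', a', e₂⟩ := z'
  obtain rfl : x = x' := e
  obtain rfl : a = a' := e'
  rfl

theorem isDiscFib_pullbackData (h : X ⟶ B) (g : A ⟶ B) (hg : IsDiscFib (Hom.functor g)) :
    IsDiscFib (Hom.functor (pullbackData h g hg.faithful).proj) := by
  refine Displayed.isDiscFib_proj _ ?_ ?_
  · rintro x x' ξ ⟨a, e⟩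
    obtain ⟨a', α, hα⟩ := hg.exists_lift a ((Hom.functor h).map ξ) e.symm
    have := IsHomLift.codomain_eq (Hom.functor g) ((Hom.functor h).map ξ) α
    exact ⟨⟨a', this.symm⟩, α, hα⟩
  · rintro x ⟨a, e⟩ ⟨a', e'⟩ ⟨α, hα⟩
    rw [CategoryTheory.Functor.map_id] at hα
    obtain rfl : a = a' := hg.eq_of_lift_id α hα
    rfl

/-- Objects of a pullback are pairs of objects. -/
theorem _root_.CategoryTheory.IsPullback.exists_obj {q : Z ⟶ X} {t : Z ⟶ A} {h : X ⟶ B}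
    {g : A ⟶ B} (H : IsPullback q t h g) (hg : (Hom.functor g).Faithful) (x : X.carrier)
    (a : A.carrier) (e : app h x = app g a) : ∃ z, app q z = x ∧ app t z = a := by
  let P := pullbackData h g hg
  let z : P.obj.carrier := ⟨x, ⟨a, e⟩⟩
  refine ⟨app (H.lift P.proj P.top P.isPullback.w) z, ?_, ?_⟩
  · rw [← app_comp, H.lift_fst]; rfl
  · rw [← app_comp, H.lift_snd]; rfl

/-- Makes an arbitrary pullback, known only by its universal property, a retract of the explicit
one, so that facts about its objects and lifts can be read off there. -/
theorem _root_.CategoryTheory.IsPullback.lift_pullbackData {q : Z ⟶ X} {t : Z ⟶ A} {h : X ⟶ B}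
    {g : A ⟶ B} (H : IsPullback q t h g) (hg : (Hom.functor g).Faithful) :
    (pullbackData h g hg).lift q t H.w ≫ H.lift (pullbackData h g hg).proj
      (pullbackData h g hg).top (pullbackData h g hg).isPullback.w = 𝟙 Z := by
  apply H.hom_ext
  · rw [Category.assoc, H.lift_fst, PullbackData.lift_proj, Category.id_comp]
  · rw [Category.assoc, H.lift_snd, PullbackData.lift_top, Category.id_comp]

/-- Objects of the explicit pullback are pairs, and the comparison morphism from `Z` to it has a
left inverse on objects. -/
theorem _root_.CategoryTheory.IsPullback.obj_ext {q : Z ⟶ X} {t : Z ⟶ A} {h : X ⟶ B}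
    {g : A ⟶ B} (H : IsPullback q t h g) (hg : (Hom.functor g).Faithful) {z z' : Z.carrier}
    (e : app q z = app q z') (e' : app t z = app t z') : z = z' := by
  have h₁ : app ((pullbackData h g hg).lift q t H.w) z =
      app ((pullbackData h g hg).lift q t H.w) z' := by
    apply pullbackData_ext
    · rwa [← app_comp, ← app_comp, PullbackData.lift_proj]
    · rwa [← app_comp, ← app_comp, PullbackData.lift_top]
  have h₂ := app_congr (H.lift_pullbackData hg)
  have h₃ := congrArg (app (H.lift (pullbackData h g hg).proj
      (pullbackData h g hg).top (pullbackData h g hg).isPullback.w)) h₁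
  rw [← app_comp, ← app_comp, h₂, h₂] at h₃
  exact h₃

/-- The lift is found in the explicit pullback, from the image of `z`, and carried back by the
retraction. -/
theorem _root_.CategoryTheory.IsPullback.exists_isHomLift {q : Z ⟶ X} {t : Z ⟶ A} {h : X ⟶ B}
    {g : A ⟶ B} (H : IsPullback q t h g) (hg : IsDiscFib (Hom.functor g)) (z : Z.carrier)
    {x x' : X.carrier} (ξ : x ⟶ x') (e : app q z = x) :
    ∃ (z' : Z.carrier) (ζ : z ⟶ z'), (Hom.functor q).IsHomLift ξ ζ := by
  let P := pullbackData h g hg.faithful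
  let m := P.lift q t H.w
  let l := H.lift P.proj P.top P.isPullback.w
  have hlm : m ≫ l = 𝟙 Z := H.lift_pullbackData hg.faithful
  have hl : l ≫ q = P.proj := H.lift_fst _ _ _
  have hz : app l (app m z) = z := app_congr hlm z
  obtain ⟨p', π, hπ⟩ := (isDiscFib_pullbackData h g hg).exists_lift (app m z) ξ
    ((app_congr (PullbackData.lift_proj P q t H.w) z).trans e)
  have key : ∃ (z' : Z.carrier) (ζ : app l (app m z) ⟶ z'), (Hom.functor q).IsHomLift ξ ζ := by
    refine ⟨app l p', (Hom.functor l).map π, ?_⟩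
    change (Hom.functor P.proj).IsHomLift ξ π at hπ
    rw [← hl] at hπ
    exact hπ.map_comp_functor
  rwa [hz] at key

end Pullback

end InvGpd

namespace InvGpd

variable {X Y Z A B D E : InvGpd.{w}}

/-! ### Dependent products of discrete fibrations along discrete fibrations. -/

section DependentProduct

variable {g : A ⟶ B} {f : D ⟶ A}

/-- `S` is the image of a section of `f` over the fibre of `g` over `b`. -/
def IsFibreSection (g : A ⟶ B) (f : D ⟶ A) (b : B.carrier) (S : Set D.carrier) : Prop :=
  (∀ d ∈ S, app (f ≫ g) d = b) ∧ ∀ a, app g a = b → ∃! d, d ∈ S ∧ app f d = a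

/-- The fibres of the dependent product of `f` along `g`, where `f` and `g` are discrete fibrations:
sections of `f` over the fibres of `g`, given by their images. -/
def piDisplayed (g : A ⟶ B) (f : D ⟶ A) (hg : IsDiscFib (Hom.functor g))
    (hf : IsDiscFib (Hom.functor f)) : Displayed B where
  fib b := {S : Set D.carrier // IsFibreSection g f b S}
  rel {b b'} β S S' := ∀ (d d' : D.carrier) (δ : d ⟶ d'),
    (Hom.functor (f ≫ g)).IsHomLift β δ → (d ∈ S.1 ↔ d' ∈ S'.1)
  rel_id S d d' δ hδ := by rw [(hf.comp hg).eq_of_lift_id δ hδ]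
  rel_comp {b b' b''} β β' {S S' S''} h h' d d' δ hδ := by
    -- A lift of the composite is split at a lift `ε` of `β` from the same source; the remainder
    -- `inv ε ≫ δ` lifts `β'`.
    obtain ⟨e, ε, hε⟩ := (hf.comp hg).exists_lift d β
      (IsHomLift.domain_eq (Hom.functor (f ≫ g)) (β ≫ β') δ)
    change (Hom.functor (f ≫ g)).IsHomLift β ε at hε
    refine (h d e ε hε).trans (h' e d' (CategoryTheory.inv ε ≫ δ) ?_)
    have : (Hom.functor (f ≫ g)).IsHomLift (CategoryTheory.inv β ≫ β ≫ β')
      (CategoryTheory.inv ε ≫ δ) := inferInstance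
    simpa using this
  rel_inv {b b'} β {S S'} h d d' δ hδ := by
    refine (h d' d (CategoryTheory.inv δ) ?_).symm
    have : (Hom.functor (f ≫ g)).IsHomLift (CategoryTheory.inv (Groupoid.inv β))
      (CategoryTheory.inv δ) := inferInstance
    simpa using this
  invol {b} S := ⟨{d | D.inv.obj d ∈ S.1}, by
    intro d hd
    have := S.2.1 _ hd
    rw [app_inv] at this
    rw [← inv_inv_obj B (app (f ≫ g) d), this], by
    intro a ha
    obtain ⟨d, ⟨hd, hda⟩, hu⟩ := S.2.2 (A.inv.obj a) (by rw [app_inv, ha, inv_inv_obj])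
    refine ⟨D.inv.obj d, ⟨?_, ?_⟩, ?_⟩
    · simpa only [Set.mem_ofPred_eq, inv_inv_obj] using hd
    · rw [app_inv, hda, inv_inv_obj]
    · rintro d' ⟨hd', hda'⟩
      rw [← hu (D.inv.obj d') ⟨hd', by rw [app_inv, hda']⟩, inv_inv_obj]⟩
  rel_invol {b b'} β S S' h d d' δ hδ := by
    refine h _ _ (D.inv.map δ) ?_
    have h₁ := isHomLift_inv (f ≫ g) hδ
    have e := Functor.congr_hom B.inv_inv β
    rw [Functor.comp_map] at e
    rw [e] at h₁
    exact (IsHomLift.lift_comp_eqToHom_iff ..).1 ((IsHomLift.lift_eqToHom_comp_iff ..).1 h₁)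
  invol_invol {b} S := by
    -- A section is recorded as a plain set of objects of `D`, whose type does not mention `b`, so
    -- the heterogeneous equality reduces to an equality of sets.
    have e : {d | D.inv.obj (D.inv.obj d) ∈ S.1} = S.1 := by
      ext d; simp only [Set.mem_ofPred_eq, inv_inv_obj]
    have key : ∀ {b' : B.carrier} {T : Set D.carrier} (hb : b' = b) (hT : T = S.1)
        (hs : IsFibreSection g f b' T), (⟨T, hs⟩ : {S // IsFibreSection g f b' S}) ≍ S := by
      rintro _ _ rfl rfl hs
      rfl
    exact key (B.inv_inv_obj b) e _

/-- The pullback of the dependent product along `g`. -/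
noncomputable abbrev piPullback (g : A ⟶ B) (f : D ⟶ A) (hg : IsDiscFib (Hom.functor g))
    (hf : IsDiscFib (Hom.functor f)) : PullbackData (piDisplayed g f hg hf).proj g :=
  pullbackData (piDisplayed g f hg hf).proj g hg.faithful

/-- The section that underlies an object of the dependent product. -/
def piSection {hg : IsDiscFib (Hom.functor g)} {hf : IsDiscFib (Hom.functor f)}
    (z : (piDisplayed g f hg hf).total.carrier) : Set D.carrier :=
  ((Displayed.Obj.elt z : {S // IsFibreSection g f (Displayed.Obj.base z) S})).1

theorem piSection_spec {hg : IsDiscFib (Hom.functor g)} {hf : IsDiscFib (Hom.functor f)}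
    (z : (piDisplayed g f hg hf).total.carrier) :
    IsFibreSection g f (app (piDisplayed g f hg hf).proj z) (piSection z) :=
  ((Displayed.Obj.elt z : {S // IsFibreSection g f (Displayed.Obj.base z) S})).2

theorem piSection_ext {hg : IsDiscFib (Hom.functor g)} {hf : IsDiscFib (Hom.functor f)}
    {z z' : (piDisplayed g f hg hf).total.carrier}
    (h : app (piDisplayed g f hg hf).proj z = app (piDisplayed g f hg hf).proj z')
    (h' : piSection z = piSection z') : z = z' := by
  obtain ⟨b, S, hS⟩ := z
  obtain ⟨b', S', hS'⟩ := z'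
  obtain rfl : b = b' := h
  obtain rfl : S = S' := h'
  rfl

theorem piSection_inv {hg : IsDiscFib (Hom.functor g)} {hf : IsDiscFib (Hom.functor f)}
    (z : (piDisplayed g f hg hf).total.carrier) (d : D.carrier) :
    d ∈ piSection ((piDisplayed g f hg hf).total.inv.obj z) ↔ D.inv.obj d ∈ piSection z := Iff.rfl

theorem piSection_rel {hg : IsDiscFib (Hom.functor g)} {hf : IsDiscFib (Hom.functor f)}
    {z z' : (piDisplayed g f hg hf).total.carrier} (ζ : z ⟶ z') {d d' : D.carrier} (δ : d ⟶ d')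
    (h : (Hom.functor (f ≫ g)).IsHomLift ((Hom.functor (piDisplayed g f hg hf).proj).map ζ) δ) :
    d ∈ piSection z ↔ d' ∈ piSection z' :=
  Subtype.property ζ d d' δ h

/-- The unique object found here is the value of the section at the given argument; evaluation is
defined by choosing it. -/
theorem piSection_existsUnique (hg : IsDiscFib (Hom.functor g)) (hf : IsDiscFib (Hom.functor f))
    (z : (piPullback g f hg hf).obj.carrier) :
    ∃! d, d ∈ piSection (app (piPullback g f hg hf).proj z) ∧
      app f d = app (piPullback g f hg hf).top z :=
  (piSection_spec _).2 _ (app_congr (piPullback g f hg hf).isPullback.w z).symm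

/-- The evaluation morphism of the dependent product. -/
noncomputable def piEv (g : A ⟶ B) (f : D ⟶ A) (hg : IsDiscFib (Hom.functor g))
    (hf : IsDiscFib (Hom.functor f)) : (piPullback g f hg hf).obj ⟶ D :=
  liftFaithful f hf.faithful (piPullback g f hg hf).top
    (fun z => (piSection_existsUnique hg hf z).choose)
    (fun z => (piSection_existsUnique hg hf z).choose_spec.1.2)
    (by
      intro z z' ζ
      obtain ⟨h₁, h₂⟩ := (piSection_existsUnique hg hf z).choose_spec.1
      -- The argument is transported along `ζ`, starting at the value over `z`. The relation on
      -- sections puts the target in the section of `z'`, so uniqueness makes it the value there.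
      obtain ⟨d', δ, hδ⟩ := hf.exists_lift _ ((Hom.functor (piPullback g f hg hf).top).map ζ) h₂
      have e : d' = (piSection_existsUnique hg hf z').choose := by
        apply (piSection_existsUnique hg hf z').choose_spec.2
        refine ⟨(piSection_rel ((Hom.functor (piPullback g f hg hf).proj).map ζ) δ ?_).1 h₁,
          hδ.target_eq⟩
        refine hδ.comp_functor (g := Hom.functor g) (IsHomLift.of_fac (Hom.functor g) _ _
          (app_congr (piPullback g f hg hf).isPullback.w z).symm
          (app_congr (piPullback g f hg hf).isPullback.w z').symm
          (Functor.congr_hom (congrArg Hom.functor (piPullback g f hg hf).isPullback.w) ζ))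
      rw [← e]
      exact ⟨δ, hδ⟩)
    (fun z => by
      obtain ⟨h₁, h₂⟩ := (piSection_existsUnique hg hf z).choose_spec.1
      refine ((piSection_existsUnique hg hf _).choose_spec.2 _ ⟨?_, ?_⟩).symm
      · rw [app_inv, piSection_inv, inv_inv_obj]
        exact h₁
      · rw [app_inv, app_inv, h₂])

theorem piEv_comp (hg : IsDiscFib (Hom.functor g)) (hf : IsDiscFib (Hom.functor f)) :
    piEv g f hg hf ≫ f = (piPullback g f hg hf).top :=
  liftFaithful_comp _ _ _ _ _ _ _

theorem app_piEv_mem (hg : IsDiscFib (Hom.functor g)) (hf : IsDiscFib (Hom.functor f))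
    (z : (piPullback g f hg hf).obj.carrier) :
    app (piEv g f hg hf) z ∈ piSection (app (piPullback g f hg hf).proj z) :=
  (piSection_existsUnique hg hf z).choose_spec.1.1

theorem app_piEv_eq (hg : IsDiscFib (Hom.functor g)) (hf : IsDiscFib (Hom.functor f))
    (z : (piPullback g f hg hf).obj.carrier) {d : D.carrier}
    (h : d ∈ piSection (app (piPullback g f hg hf).proj z))
    (h' : app f d = app (piPullback g f hg hf).top z) : app (piEv g f hg hf) z = d :=
  ((piSection_existsUnique hg hf z).choose_spec.2 d ⟨h, h'⟩).symm

/-- The fibre of `Q` over `x` is the fibre of `g` over `app h x`, and `w` is a morphism over `A`; so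
the image under `w` of this fibre contains exactly one object above each argument. This image is the
value at `x` of the transpose of `w`. -/
theorem isFibreSection_image {h : X ⟶ B} (hg : IsDiscFib (Hom.functor g)) (Q : PullbackData h g)
    (w : Q.obj ⟶ D) (hw : w ≫ f = Q.top) (x : X.carrier) :
    IsFibreSection g f (app h x) {d | ∃ q, app Q.proj q = x ∧ app w q = d} := by
  constructor
  · rintro _ ⟨q, rfl, rfl⟩
    rw [← app_comp, ← Category.assoc, hw, ← app_comp, Q.isPullback.w]
  · intro a ha
    obtain ⟨q, hq, hq'⟩ := Q.isPullback.exists_obj hg.faithful x a ha.symm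
    refine ⟨app w q, ⟨⟨q, hq, rfl⟩, by rw [← app_comp, hw, hq']⟩, ?_⟩
    rintro _ ⟨⟨q', hq₁, rfl⟩, hq₂⟩
    rw [← app_comp, hw] at hq₂
    rw [Q.isPullback.obj_ext hg.faithful (hq₁.trans hq.symm) (hq₂.trans hq'.symm)]

/-- Lift `ξ` to `Q` and apply `w`: the result and `δ` lift the same morphism from the same source,
so they have the same target. This makes the transpose of `w` functorial. -/
theorem mem_image_of_isHomLift {h : X ⟶ B} (hg : IsDiscFib (Hom.functor g))
    (hf : IsDiscFib (Hom.functor f)) (Q : PullbackData h g)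
    (w : Q.obj ⟶ D) (hw : w ≫ f = Q.top) {x x' : X.carrier} (ξ : x ⟶ x') {d d' : D.carrier}
    (δ : d ⟶ d') (hδ : (Hom.functor (f ≫ g)).IsHomLift ((Hom.functor h).map ξ) δ)
    (hd : ∃ q, app Q.proj q = x ∧ app w q = d) : ∃ q, app Q.proj q = x' ∧ app w q = d' := by
  obtain ⟨q, rfl, rfl⟩ := hd
  obtain ⟨q', ζ, hζ⟩ := Q.isPullback.exists_isHomLift hg q ξ rfl
  refine ⟨q', IsHomLift.codomain_eq (Hom.functor Q.proj) ξ ζ,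
    (hf.comp hg).target_unique (δ₁ := (Hom.functor w).map ζ) ?_ hδ⟩
  have e : w ≫ f ≫ g = Q.proj ≫ h := by rw [← Category.assoc, hw, Q.isPullback.w]
  exact Functor.IsHomLift.map_of_comm (congrArg Hom.functor e) hζ

/-- The morphism to the dependent product that corresponds to a morphism from a pullback. -/
noncomputable def piLam (g : A ⟶ B) (f : D ⟶ A) (hg : IsDiscFib (Hom.functor g))
    (hf : IsDiscFib (Hom.functor f)) (h : X ⟶ B) (Q : PullbackData h g) (w : Q.obj ⟶ D)
    (hw : w ≫ f = Q.top) : X ⟶ (piDisplayed g f hg hf).total :=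
  liftFaithful (piDisplayed g f hg hf).proj (Displayed.proj_faithful _) h
    (fun x => ⟨app h x, ⟨_, isFibreSection_image hg Q w hw x⟩⟩)
    (fun x => rfl)
    (fun x x' ξ => ⟨Displayed.homMk _ ((Hom.functor h).map ξ) (fun d d' δ hδ =>
      ⟨mem_image_of_isHomLift hg hf Q w hw ξ δ hδ, by
        -- The converse inclusion is the same closure property for the inverse morphisms.
        refine mem_image_of_isHomLift hg hf Q w hw (CategoryTheory.inv ξ)
          (CategoryTheory.inv δ) ?_
        rw [CategoryTheory.Functor.map_inv]
        exact hδ.inverse⟩), Displayed.isHomLift_homMk _ _ _⟩)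
    (fun x => by
      refine piSection_ext ?_ ?_
      · exact app_inv h x
      ext d
      change (∃ q, app Q.proj q = X.inv.obj x ∧ app w q = d) ↔
        ∃ q, app Q.proj q = x ∧ app w q = D.inv.obj d
      constructor
      · rintro ⟨q, hq, rfl⟩
        exact ⟨Q.obj.inv.obj q, by rw [app_inv, hq, inv_inv_obj], app_inv _ _⟩
      · rintro ⟨q, hq, hd⟩
        exact ⟨Q.obj.inv.obj q, by rw [app_inv, hq], by rw [app_inv, hd, inv_inv_obj]⟩)

theorem piLam_proj (hg : IsDiscFib (Hom.functor g)) (hf : IsDiscFib (Hom.functor f)) (h : X ⟶ B)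
    (Q : PullbackData h g) (w : Q.obj ⟶ D) (hw : w ≫ f = Q.top) :
    piLam g f hg hf h Q w hw ≫ (piDisplayed g f hg hf).proj = h :=
  liftFaithful_comp _ _ _ _ _ _ _

theorem mem_piSection_piLam (hg : IsDiscFib (Hom.functor g)) (hf : IsDiscFib (Hom.functor f))
    (h : X ⟶ B) (Q : PullbackData h g) (w : Q.obj ⟶ D) (hw : w ≫ f = Q.top) (x : X.carrier)
    (d : D.carrier) : d ∈ piSection (app (piLam g f hg hf h Q w hw) x) ↔
      ∃ q, app Q.proj q = x ∧ app w q = d := Iff.rfl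

/-- Dependent products of discrete fibrations along discrete fibrations. -/
noncomputable def depProd (g : A ⟶ B) (f : D ⟶ A) (hg : IsDiscFib (Hom.functor g))
    (hf : IsDiscFib (Hom.functor f)) : DepProd g f where
  obj := (piDisplayed g f hg hf).total
  proj := (piDisplayed g f hg hf).proj
  pb := piPullback g f hg hf
  ev := piEv g f hg hf
  ev_comp := piEv_comp hg hf
  universal {X} h Q w hw := by
    refine ⟨piLam g f hg hf h Q w hw, ⟨piLam_proj hg hf h Q w hw, ?_⟩, ?_⟩
    · refine ext_of_faithful f hf.faithful ?_ fun q => ?_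
      · rw [Category.assoc, piEv_comp, PullbackData.lift_top, hw]
      · rw [app_comp]
        apply app_piEv_eq
        · rw [← app_comp, PullbackData.lift_proj, app_comp, mem_piSection_piLam]
          exact ⟨q, rfl, rfl⟩
        · rw [← app_comp, ← app_comp, PullbackData.lift_top, hw]
    · rintro k ⟨hk, hk'⟩
      have e := hk.trans (piLam_proj hg hf h Q w hw).symm
      refine ext_of_faithful _ (Displayed.proj_faithful _) e
        fun x => piSection_ext (app_congr e x) ?_
      -- The values of `w` belong to the sections given by `k`. Since a section has only one element
      -- above each argument, this containment forces equality.
      have key : ∀ q, app w q ∈ piSection (app k (app Q.proj q)) := by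
        intro q
        rw [← hk', app_comp]
        have := app_piEv_mem hg hf (app ((piPullback g f hg hf).lift (Q.proj ≫ k) Q.top
          (by rw [Category.assoc, hk]; exact Q.isPullback.w)) q)
        rwa [← app_comp _ (piPullback g f hg hf).proj, PullbackData.lift_proj, app_comp] at this
      ext d
      rw [mem_piSection_piLam]
      constructor
      · intro hd
        have hb : app g (app f d) = app h x := by
          rw [← app_comp, (piSection_spec _).1 d hd, ← app_comp, hk]
        obtain ⟨q, hq, hq'⟩ := Q.isPullback.exists_obj hg.faithful x _ hb.symm
        refine ⟨q, hq, ((piSection_spec (app k x)).2 (app f d) ?_).unique ⟨hq ▸ key q, ?_⟩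
          ⟨hd, rfl⟩⟩
        · rw [hb, ← app_comp, hk]
        · rw [← app_comp, hw, hq']
      · rintro ⟨q, rfl, rfl⟩
        exact key q

end DependentProduct

end InvGpd

/-! ### Existence of an interpretation: path objects, the assembled data, and `p_Δ`. -/

theorem IsDiscFib.id (A : Type*) [Category A] : IsDiscFib (𝟭 A) where
  faithful := inferInstance
  exists_lift := by
    rintro d _ a' α rfl
    exact ⟨a', α, Functor.IsHomLift.map (p := 𝟭 A) α⟩
  eq_of_lift_id δ h := h.source_eq.trans h.target_eq.symm

/-- A lift of `g.map α` along `f ⋙ g` has an image under `f` that lifts `g.map α` from the same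
source as `α`; uniqueness of lifts along `g` identifies it with `α`. -/
theorem IsDiscFib.of_comp {D A B : Type*} [Groupoid D] [Groupoid A] [Groupoid B] {f : D ⥤ A}
    {g : A ⥤ B} (hfg : IsDiscFib (f ⋙ g)) (hg : IsDiscFib g) : IsDiscFib f where
  faithful := by
    have := hfg.faithful
    exact Functor.Faithful.of_comp f g
  exists_lift := by
    rintro d _ a' α rfl
    obtain ⟨d', δ, hδ⟩ := hfg.exists_lift d (g.map α) rfl
    have h := hδ.map_comp_functor
    have e := hg.target_unique h (Functor.IsHomLift.map α)
    refine ⟨d', δ, IsHomLift.of_fac f _ _ rfl e ?_⟩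
    have := hg.faithful
    apply g.map_injective
    simpa [eqToHom_map] using IsHomLift.fac g (g.map α) (f.map δ)
  eq_of_lift_id {d d' a} δ h := by
    refine hfg.eq_of_lift_id (a := g.obj a) δ (h.comp_functor ?_)
    exact IsHomLift.of_fac _ _ _ rfl rfl (by simp)

namespace InvGpd

variable {X Y Z A B D E U : InvGpd.{w}}

/-- The product of two groupoids with involution. -/
def prod (X Y : InvGpd.{w}) : InvGpd.{w} where
  carrier := X.carrier × Y.carrier
  inv := X.inv.prod Y.inv
  inv_inv := by
    change (X.inv ⋙ X.inv).prod (Y.inv ⋙ Y.inv) = _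
    rw [X.inv_inv, Y.inv_inv]
    rfl

/-- The first projection. -/
def prodFst (X Y : InvGpd.{w}) : prod X Y ⟶ X where
  functor := CategoryTheory.Prod.fst _ _
  comm := rfl

/-- The second projection. -/
def prodSnd (X Y : InvGpd.{w}) : prod X Y ⟶ Y where
  functor := CategoryTheory.Prod.snd _ _
  comm := rfl

/-- The morphism to the product given by its components. -/
def prodLift (f : Z ⟶ X) (g : Z ⟶ Y) : Z ⟶ prod X Y where
  functor := (Hom.functor f).prod' (Hom.functor g)
  comm := by
    change (Z.inv ⋙ Hom.functor f).prod' (Z.inv ⋙ Hom.functor g) =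
      (Hom.functor f ⋙ X.inv).prod' (Hom.functor g ⋙ Y.inv)
    rw [Hom.comm f, Hom.comm g]

/-- The product is a product. -/
def isLimitProd (X Y : InvGpd.{w}) : IsLimit (BinaryFan.mk (prodFst X Y) (prodSnd X Y)) :=
  BinaryFan.isLimitMk (fun s => prodLift s.fst s.snd) (fun s => rfl) (fun s => rfl)
    (fun s m h₁ h₂ => by
      rw [← h₁, ← h₂]
      rfl)

theorem projFib_of_isDiscFib {f : X ⟶ Y} (hf : IsDiscFib (Hom.functor f)) : projFib f := by
  intro x y h
  obtain ⟨x', g, hg⟩ := hf.exists_lift x h rfl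
  exact ⟨x', g, hg.target_eq, by simpa using (IsHomLift.fac (Hom.functor f) h g).symm⟩

/-- The diagonal followed by the projection, itself a discrete fibration, is the identity, so
cancellation applies. Thus identity types may be interpreted by the diagonal itself. -/
theorem isDiscFib_diagonal {p : E ⟶ U} (hp : IsDiscFib (Hom.functor p)) :
    IsDiscFib (Hom.functor ((pullbackData p p hp.faithful).lift (𝟙 E) (𝟙 E) rfl)) := by
  refine IsDiscFib.of_comp (g := Hom.functor (pullbackData p p hp.faithful).proj) ?_
    (isDiscFib_pullbackData p p hp)
  have h := congrArg Hom.functor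
    (PullbackData.lift_proj (pullbackData p p hp.faithful) (𝟙 E) (𝟙 E) rfl)
  change Hom.functor _ ⋙ Hom.functor _ = 𝟭 _ at h
  rw [h]
  exact IsDiscFib.id _

/-- The path object of a discrete fibration whose second factor is the diagonal. -/
noncomputable def diagonalPath (p : E ⟶ U) (hp : IsDiscFib (Hom.functor p)) :
    PathData projFib p where
  prod := pullbackData p p hp.faithful
  obj := E
  refl := 𝟙 E
  ends := (pullbackData p p hp.faithful).lift (𝟙 E) (𝟙 E) rfl
  acyclic := fun _ _ _ _ => inferInstance
  fib := projFib_of_isDiscFib (isDiscFib_diagonal hp)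
  fac := Category.id_comp _

/-- Function types between pullbacks of a discrete fibration. -/
noncomputable def funData (p : E ⟶ U) (hp : IsDiscFib (Hom.functor p)) {Γ : InvGpd.{w}}
    (a b : Γ ⟶ U) : FunData p a b where
  dom := pullbackData a p hp.faithful
  cod := pullbackData _ p hp.faithful
  pi := depProd _ _ (isDiscFib_pullbackData a p hp) (isDiscFib_pullbackData _ p hp)

/-- Dependent products of identity types of a discrete fibration. -/
noncomputable def piIdData (p : E ⟶ U) (hp : IsDiscFib (Hom.functor p)) {Γ : InvGpd.{w}}
    (a : Γ ⟶ U) (t : (pullbackData a p hp.faithful).obj ⟶ E)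
    (ht : t ≫ p = (pullbackData a p hp.faithful).top ≫ p) :
    PiIdData (diagonalPath p hp) (pullbackData a p hp.faithful) t ht where
  idTy := pullbackData _ _ (isDiscFib_diagonal hp).faithful
  pi := depProd _ _ (isDiscFib_pullbackData a p hp) (isDiscFib_pullbackData _ _
    (isDiscFib_diagonal hp))

/-- The types of functions between pullbacks of a discrete fibration, in both directions. -/
noncomputable def functionsData (p : E ⟶ U) (hp : IsDiscFib (Hom.functor p)) :
    FunctionsData projFib p where
  base := prod U U
  tyA := prodFst U U
  tyB := prodSnd U U
  isProd := isLimitProd U U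
  path := diagonalPath p hp
  hom := funData p hp _ _
  back := funData p hp _ _

theorem faithful_comp {f : X ⟶ Y} {g : Y ⟶ Z} (hf : (Hom.functor f).Faithful)
    (hg : (Hom.functor g).Faithful) : (Hom.functor (f ≫ g)).Faithful :=
  inferInstanceAs (Hom.functor f ⋙ Hom.functor g).Faithful

/-- The types of equivalences between pullbacks of a discrete fibration. -/
noncomputable def equivData (p : E ⟶ U) (hp : IsDiscFib (Hom.functor p)) :
    EquivData projFib p where
  toFunctionsData := functionsData p hp
  domB := pullbackData _ p hp.faithful
  rinv := piIdData p hp _ _ _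
  domA := pullbackData _ p hp.faithful
  linv := piIdData p hp _ _ _
  total := pullbackData _ _
    (faithful_comp (Displayed.proj_faithful _) (Displayed.proj_faithful _))

end InvGpd

/-- The point is transported by `ρ₀`. As the fibres are sets, a morphism over an identity must fix
the point. -/
theorem isDiscFib_forgetPt (κ : Cardinal.{u}) : IsDiscFib (forgetPt κ) where
  faithful := ⟨fun h => PtUHom.ext (congrArg UHom.fst h) (congrArg UHom.snd h)⟩
  exists_lift := by
    rintro d _ a' α rfl
    exact ⟨⟨a', α.fst d.pt⟩, ⟨α, rfl⟩, Functor.IsHomLift.map (p := forgetPt κ) (a := d)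
      (b := ⟨a', α.fst d.pt⟩) ⟨α, rfl⟩⟩
  eq_of_lift_id := by
    rintro ⟨A, x⟩ ⟨A', x'⟩ a δ h
    obtain rfl : A = a := h.source_eq
    obtain rfl : A' = A := h.target_eq
    have e : 𝟙 A' = (forgetPt κ).map δ :=
      @IsHomLift.eq_of_isHomLift _ _ _ _ (forgetPt κ) ⟨A', x⟩ ⟨A', x'⟩ (𝟙 A') δ h
    have e' : x = δ.fst x := congrArg (fun k : UHom A' A' => k.fst x) e
    rw [e']
    congr 1
    exact δ.map_pt

theorem isDiscFib_pΔ (κ : Cardinal.{u}) : IsDiscFib (InvGpd.Hom.functor (pΔ κ)) :=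
  isDiscFib_forgetPt κ

/-! ### Terms in an arbitrary category: automorphisms as equivalences. -/

section Terms

variable {C : Type u} [Category.{v} C] {E U : C} {F : MorphismProperty C} {p : E ⟶ U}
  {Γ X Q : C} {a b : Γ ⟶ U}

theorem PullbackData.comp_condition {c : X ⟶ Γ} {q : Q ⟶ X} {t : Q ⟶ E}
    (H : IsPullback q t (c ≫ a) p) : (q ≫ c) ≫ a = t ≫ p := by
  rw [Category.assoc, H.w]

/-- The function `c ⊢ λ x, r x`, where the type `A` in context `X` is given by the pullback `q`. -/
noncomputable def FunData.lamFun (M : FunData p a b) (c : X ⟶ Γ) (q : Q ⟶ X) (t : Q ⟶ E)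
    (H : IsPullback q t (c ≫ a) p) (r : Q ⟶ E) (hr : r ≫ p = q ≫ c ≫ b) : X ⟶ M.pi.obj :=
  M.pi.lam c (M.dom.restrict c q t H)
    (M.cod.lift (M.dom.lift (q ≫ c) t (PullbackData.comp_condition H)) r
      (by rw [← Category.assoc, PullbackData.lift_proj, hr, Category.assoc]))
    (by rw [PullbackData.lift_proj])

theorem FunData.lamFun_proj (M : FunData p a b) (c : X ⟶ Γ) (q : Q ⟶ X) (t : Q ⟶ E)
    (H : IsPullback q t (c ≫ a) p) (r : Q ⟶ E) (hr : r ≫ p = q ≫ c ≫ b) :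
    M.lamFun c q t H r hr ≫ M.pi.proj = c :=
  DepProd.lam_proj _ _ _ _ _

/-- The β-rule. The function and the argument are variables `k` and `x` with equations, so that it
applies without rewriting inside the compatibility proof `hx`. -/
theorem FunData.app_lamFun (M : FunData p a b) (c : X ⟶ Γ) (q : Q ⟶ X) (t : Q ⟶ E)
    (H : IsPullback q t (c ≫ a) p) (r : Q ⟶ E) (hr : r ≫ p = q ≫ c ≫ b) {Y : C} (y : Y ⟶ Q)
    (k : Y ⟶ M.pi.obj) (x : Y ⟶ E) (hk : k = y ≫ q ≫ M.lamFun c q t H r hr) (hxt : x = y ≫ t)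
    (hx : k ≫ M.pi.proj ≫ a = x ≫ p) : M.app k x hx = y ≫ r := by
  have h := M.pi.app_lam c (M.dom.restrict c q t H)
    (M.cod.lift (M.dom.lift (q ≫ c) t (PullbackData.comp_condition H)) r
      (by rw [← Category.assoc, PullbackData.lift_proj, hr, Category.assoc]))
    (by rw [PullbackData.lift_proj]) y k
    (M.dom.lift (k ≫ M.pi.proj) x (by simpa using hx)) hk ?_ (by rw [PullbackData.lift_proj])
  · rw [FunData.app, h, Category.assoc, PullbackData.lift_top]
  apply M.dom.hom_ext
  · rw [PullbackData.lift_proj, hk, Category.assoc, Category.assoc, lamFun_proj]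
    simp only [PullbackData.restrict, Category.assoc, PullbackData.lift_proj]
  · rw [PullbackData.lift_top]
    simp only [PullbackData.restrict, Category.assoc, PullbackData.lift_top, hxt]

/-- The term `x ↦ refl` of `Π (x : A), Id_A (t x) x` in a context in which `t x` is `x`. -/
noncomputable def PiIdData.reflLam {P : PathData F p} {dom : PullbackData a p} {t : dom.obj ⟶ E}
    {ht : t ≫ p = dom.top ≫ p} (M : PiIdData P dom t ht) (c : X ⟶ Γ) (q : Q ⟶ X) (x : Q ⟶ E)
    (H : IsPullback q x (c ≫ a) p)
    (h : dom.lift (q ≫ c) x (PullbackData.comp_condition H) ≫ t = x) : X ⟶ M.pi.obj :=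
  M.pi.lam c (dom.restrict c q x H)
    -- By `h` the pair `(t x, x)` is the diagonal at `x`, which is where `x ≫ P.refl` lies.
    (M.idTy.lift (dom.lift (q ≫ c) x (PullbackData.comp_condition H)) (x ≫ P.refl) (by
      rw [Category.assoc, P.fac]
      apply P.prod.hom_ext
      · simp only [Category.assoc, PullbackData.lift_proj, h, Category.comp_id]
      · simp only [Category.assoc, PullbackData.lift_top, Category.comp_id]))
    (by rw [PullbackData.lift_proj])

theorem PiIdData.reflLam_proj {P : PathData F p} {dom : PullbackData a p} {t : dom.obj ⟶ E}
    {ht : t ≫ p = dom.top ≫ p} (M : PiIdData P dom t ht) (c : X ⟶ Γ) (q : Q ⟶ X) (x : Q ⟶ E)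
    (H : IsPullback q x (c ≫ a) p)
    (h : dom.lift (q ≫ c) x (PullbackData.comp_condition H) ≫ t = x) :
    M.reflLam c q x H h ≫ M.pi.proj = c :=
  DepProd.lam_proj _ _ _ _ _

namespace EquivData

variable (I : EquivData F p)

theorem idEquiv_toHom : I.idEquiv ≫ I.toHom = I.idHom := by
  rw [idEquiv, ← Category.assoc, PullbackData.lift_proj, ← Category.assoc, PiIdData.reflFun_proj,
    FunctionsData.idBack_proj]

/-- An automorphism of a type, given by mutually inverse morphisms, is a term of the type of
equivalences. -/
theorem exists_of_automorphism {A : X ⟶ U} {q : Q ⟶ X} {t : Q ⟶ E} (H : IsPullback q t A p)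
    {σ τ : Q ⟶ Q} (hσ : σ ≫ q = q) (hτ : τ ≫ q = q) (hστ : σ ≫ τ = 𝟙 Q) (hτσ : τ ≫ σ = 𝟙 Q) :
    ∃ e : X ⟶ I.space, e ≫ I.toBase ≫ I.tyA = A ∧ e ≫ I.toBase ≫ I.tyB = A ∧
      ∀ {Y : C} (y : Y ⟶ Q) (hx : (y ≫ q ≫ e ≫ I.toHom) ≫ I.hom.pi.proj ≫ I.tyA = (y ≫ t) ≫ p),
        I.hom.app (y ≫ q ≫ e ≫ I.toHom) (y ≫ t) hx = y ≫ σ ≫ t := by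
  obtain ⟨c, hcA, hcB⟩ : ∃ c : X ⟶ I.base, c ≫ I.tyA = A ∧ c ≫ I.tyB = A :=
    ⟨I.isProd.lift (BinaryFan.mk A A), I.isProd.fac (BinaryFan.mk A A) ⟨WalkingPair.left⟩,
      I.isProd.fac (BinaryFan.mk A A) ⟨WalkingPair.right⟩⟩
  have hσt : (σ ≫ t) ≫ p = q ≫ A := by rw [Category.assoc, ← H.w, reassoc_of% hσ]
  have hτt : (τ ≫ t) ≫ p = q ≫ A := by rw [Category.assoc, ← H.w, reassoc_of% hτ]
  -- The function is `x ↦ σ x`; the function `s` in the opposite direction below is `x ↦ τ x`.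
  let f : X ⟶ I.hom.pi.obj := I.hom.lamFun c q t (by rwa [hcA]) (σ ≫ t) (by rw [hσt, hcB])
  have hf : f ≫ I.hom.pi.proj = c := I.hom.lamFun_proj ..
  have hfA : f ≫ I.hom.pi.proj ≫ I.tyA = A := by rw [← Category.assoc, hf, hcA]
  have hfB : f ≫ I.hom.pi.proj ≫ I.tyB = A := by rw [← Category.assoc, hf, hcB]
  have appf : ∀ {Y : C} (y : Y ⟶ Q) (k : Y ⟶ I.hom.pi.obj) (x : Y ⟶ E) (hk : k = y ≫ q ≫ f)
      (hxt : x = y ≫ t) (hx : k ≫ I.hom.pi.proj ≫ I.tyA = x ≫ p),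
      I.hom.app k x hx = y ≫ σ ≫ t := fun y k x hk hxt hx =>
    I.hom.app_lamFun c q t _ (σ ≫ t) _ y k x hk hxt hx
  let s : X ⟶ I.back.pi.obj := I.back.lamFun f q t (by rwa [hfB]) (τ ≫ t) (by rw [hτt, hfA])
  have hs : s ≫ I.back.pi.proj = f := I.back.lamFun_proj ..
  have hsA : s ≫ I.ctxA = A := by rw [← Category.assoc, hs, hfA]
  have hsB : s ≫ I.ctxB = A := by rw [← Category.assoc, hs, hfB]
  have apps : ∀ {Y : C} (y : Y ⟶ Q) (k : Y ⟶ I.back.pi.obj) (x : Y ⟶ E) (hk : k = y ≫ q ≫ s)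
      (hxt : x = y ≫ t) (hx : k ≫ I.back.pi.proj ≫ I.hom.pi.proj ≫ I.tyB = x ≫ p),
      I.back.app k x (by simpa using hx) = y ≫ τ ≫ t := fun y k x hk hxt hx =>
    I.back.app_lamFun f q t _ (τ ≫ t) _ y k x hk hxt _
  have HB : IsPullback q t (s ≫ I.ctxB) p := by rwa [hsB]
  have HA : IsPullback q t (s ≫ I.ctxA) p := by rwa [hsA]
  have fsb : I.domB.lift (q ≫ s) t (PullbackData.comp_condition HB) ≫ I.fsb I.domB = t := by
    have h₁ : I.domB.lift (q ≫ s) t (PullbackData.comp_condition HB) ≫ I.sb I.domB = τ ≫ t := by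
      rw [FunctionsData.sb, FunctionsData.comp_funApp,
        FunctionsData.funApp_congr _ (PullbackData.lift_top _ _ _ _)]
      refine (apps (𝟙 Q) _ _ ?_ (Category.id_comp _).symm _).trans (Category.id_comp _)
      rw [PullbackData.lift_proj, Category.id_comp]
    rw [FunctionsData.fsb, FunctionsData.comp_funApp, FunctionsData.funApp_congr _ h₁]
    -- Evaluating `f` at `τ x` gives `σ (τ x)`, which is `x` strictly, so reflexivity will inhabit
    -- the identity type.
    refine (appf τ _ _ ?_ rfl _).trans (by rw [← Category.assoc, hτσ, Category.id_comp])
    rw [← Category.assoc, PullbackData.lift_proj, Category.assoc, hs, reassoc_of% hτ]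
  have sfa : I.domA.lift (q ≫ s) t (PullbackData.comp_condition HA) ≫ I.sfa I.domA = t := by
    have h₁ : I.domA.lift (q ≫ s) t (PullbackData.comp_condition HA) ≫ I.fa I.domA = σ ≫ t := by
      rw [FunctionsData.fa, FunctionsData.comp_funApp,
        FunctionsData.funApp_congr _ (PullbackData.lift_top _ _ _ _)]
      refine (appf (𝟙 Q) _ _ ?_ (Category.id_comp _).symm _).trans (Category.id_comp _)
      rw [← Category.assoc, PullbackData.lift_proj, Category.assoc, hs, Category.id_comp]
    rw [FunctionsData.sfa, FunctionsData.comp_funApp, FunctionsData.funApp_congr _ h₁]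
    refine (apps σ _ _ ?_ rfl _).trans (by rw [← Category.assoc, hστ, Category.id_comp])
    rw [PullbackData.lift_proj, reassoc_of% hσ]
  -- The same `s` is used as right and as left inverse, each with the reflexivity homotopy; the two
  -- components agree because both lie over `f`.
  let e : X ⟶ I.space := I.total.lift (I.rinv.reflLam s q t HB fsb) (I.linv.reflLam s q t HA sfa)
    ((Category.assoc _ _ _).symm.trans
      ((congrArg (· ≫ I.back.pi.proj)
        ((I.rinv.reflLam_proj ..).trans (I.linv.reflLam_proj ..).symm)).trans
        (Category.assoc _ _ _)))
  have he : e ≫ I.toHom = f := by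
    rw [← Category.assoc, PullbackData.lift_proj, ← Category.assoc, PiIdData.reflLam_proj, hs]
  refine ⟨e, ?_, ?_, fun y hx => appf y _ _ (by rw [he]) rfl hx⟩
  · rw [Category.assoc, ← Category.assoc, he, hfA]
  · rw [Category.assoc, ← Category.assoc, he, hfB]

end EquivData

end Terms

namespace InvGpd

variable {X Y P : InvGpd.{w}}

/-! ### Acyclic cofibrations and homotopy equivalences on fixed points. -/

section FixedPoints

/-- The fibres of a fibration to `P` through which `r : Y ⟶ P` factors and whose fixed points come
from `Y`: a free orbit is added to `Y` over every object of `P`. -/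
def freeCoverDisplayed (r : Y ⟶ P) : Displayed P where
  fib p := {y : Y.carrier // app r y = p} ⊕ ULift.{w} Bool
  rel _ _ _ := True
  rel_id _ := trivial
  rel_comp _ _ _ _ _ _ _ := trivial
  rel_inv _ _ _ _ := trivial
  invol := Sum.map (fun y => ⟨Y.inv.obj y.1, by rw [app_inv]; exact congrArg P.inv.obj y.2⟩)
    fun i => ⟨!i.down⟩
  rel_invol _ _ _ _ := trivial
  invol_invol {p} t := by
    have key : ∀ {p'} (hp : p' = p) {y y' : Y.carrier} (hy : y = y') (h : app r y = p')
        (h' : app r y' = p), (Sum.inl ⟨y, h⟩ : {y : Y.carrier // app r y = p'} ⊕ ULift.{w} Bool) ≍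
          (Sum.inl ⟨y', h'⟩ : {y : Y.carrier // app r y = p} ⊕ ULift.{w} Bool) := by
      rintro _ rfl _ _ rfl _ _
      rfl
    have key' : ∀ {p'} (hp : p' = p) {i j : ULift.{w} Bool} (hi : i = j),
        (Sum.inr i : {y : Y.carrier // app r y = p'} ⊕ ULift.{w} Bool) ≍
          (Sum.inr j : {y : Y.carrier // app r y = p} ⊕ ULift.{w} Bool) := by
      rintro _ rfl _ _ rfl
      rfl
    rcases t with ⟨y, h⟩ | i
    · exact key (P.inv_inv_obj p) (Y.inv_inv_obj y) _ _
    · exact key' (P.inv_inv_obj p) (by simp)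

/-- Every morphism of the base underlies a morphism between any two objects above its ends, so a
point of the added orbit can always be the target. The lift need not respect the involution, which
is what lets the added orbits be free. -/
theorem freeCover_projFib (r : Y ⟶ P) : projFib (freeCoverDisplayed r).proj := by
  intro x p h
  exact ⟨⟨p, Sum.inr ⟨true⟩⟩, ⟨h, trivial⟩, rfl, Category.comp_id _⟩

/-- The inclusion of `Y` in the free cover. -/
noncomputable def freeCoverIncl (r : Y ⟶ P) : Y ⟶ (freeCoverDisplayed r).total :=
  liftFaithful (freeCoverDisplayed r).proj (Displayed.proj_faithful _) r
    (fun y => ⟨app r y, Sum.inl ⟨y, rfl⟩⟩) (fun y => rfl)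
    (fun y y' η => ⟨Displayed.homMk _ ((Hom.functor r).map η) trivial,
      Displayed.isHomLift_homMk _ _ _⟩)
    (fun y => by
      have key : ∀ {p} (y : Y.carrier) (h : app r y = p),
          (⟨app r y, Sum.inl ⟨y, rfl⟩⟩ : (freeCoverDisplayed r).Obj) = ⟨p, Sum.inl ⟨y, h⟩⟩ := by
        rintro _ y rfl
        rfl
      exact key (Y.inv.obj y) _)

theorem freeCoverIncl_proj (r : Y ⟶ P) : freeCoverIncl r ≫ (freeCoverDisplayed r).proj = r :=
  liftFaithful_comp _ _ _ _ _ _ _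

/-- The involution negates the Boolean label of an added point, so a fixed point cannot be one of
these. -/
theorem freeCover_fix (r : Y ⟶ P) (z : (freeCoverDisplayed r).total.Fix) :
    ∃ y : Y.Fix, app r y.1 = app (freeCoverDisplayed r).proj z.1 := by
  obtain ⟨⟨p, t⟩, h⟩ := z
  rcases t with ⟨y, hy⟩ | i
  -- The map `φ` reads off the element in a type independent of the base object, so that the fixed
  -- point equation can be applied to it directly.
  · let φ : (freeCoverDisplayed r).Obj → Option Y.carrier :=
      fun z => Sum.elim (fun y => some y.1) (fun _ => none) z.elt
    exact ⟨⟨y, Option.some.inj (congrArg φ h)⟩, hy⟩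
  · let φ : (freeCoverDisplayed r).Obj → Option Bool :=
      fun z => Sum.elim (fun _ => none) (fun i => some i.down) z.elt
    have : some (!i.down) = some i.down := congrArg φ h
    simp at this

/-- Acyclic cofibrations are surjective on fixed points. -/
theorem mapFix_surjective_of_llp {r : Y ⟶ P} (hr : projFib.llp r) :
    Function.Surjective (mapFix r) := by
  intro p
  -- A diagonal filler is a section of the free cover; it sends a fixed point of `P` to a fixed
  -- point above it, which comes from `Y`.
  have sq : CommSq (freeCoverIncl r) r (freeCoverDisplayed r).proj (𝟙 P) :=
    ⟨by rw [freeCoverIncl_proj, Category.comp_id]⟩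
  obtain ⟨⟨l, -, hl⟩⟩ := ((hr _ (freeCover_projFib r)).sq_hasLift sq).exists_lift
  obtain ⟨y, hy⟩ := freeCover_fix r (mapFix l p)
  refine ⟨y, Subtype.ext (hy.trans ?_)⟩
  exact app_congr hl p.1

/-- A homotopy takes a fixed point to a fixed point of the path object. This is the reflexivity at
some `y`, since `refl` is an acyclic cofibration, so both ends equal `y`. -/
theorem app_eq_of_rightHomotopic {f g : X ⟶ Y} (h : RightHomotopic projFib f g) (x : X.Fix) :
    app f x.1 = app g x.1 := by
  obtain ⟨T, hT, P, H, rfl, rfl⟩ := h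
  obtain ⟨y, hy⟩ := mapFix_surjective_of_llp P.acyclic (mapFix H x)
  have hy' : app P.refl y.1 = app H x.1 := congrArg Subtype.val hy
  have h₁ : P.refl ≫ P.ends ≫ P.prod.proj = 𝟙 Y := by
    rw [reassoc_of% P.fac, PullbackData.lift_proj]
  have h₂ : P.refl ≫ P.ends ≫ P.prod.top = 𝟙 Y := by
    rw [reassoc_of% P.fac, PullbackData.lift_top]
  rw [app_comp H, app_comp H, ← hy']
  exact (app_congr h₁ y.1).trans (app_congr h₂ y.1).symm

/-- Homotopy equivalences are surjective on fixed points. -/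
theorem mapFix_surjective_of_isHomotopyEquiv {f : X ⟶ Y} (h : IsHomotopyEquiv projFib f) :
    Function.Surjective (mapFix f) := by
  obtain ⟨g, hg, -⟩ := h
  exact fun y => ⟨mapFix g y, Subtype.ext (app_eq_of_rightHomotopic hg y)⟩

end FixedPoints

/-! ### Discrete groupoids with trivial involution, whose morphisms to `X` are families of fixed
points. -/

section Discrete

/-- The discrete groupoid on a set, with the trivial involution. -/
def disc (J : Type w) : InvGpd.{w} where
  carrier := Discrete J
  inv := 𝟭 _
  inv_inv := rfl

variable {J K : Type w}

instance (x y : (disc J).carrier) : Subsingleton (x ⟶ y) :=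
  inferInstanceAs (Subsingleton (ULift (PLift (Discrete.as x = Discrete.as y))))

theorem disc_eq_of_hom {x y : (disc J).carrier} (h : x ⟶ y) : x = y :=
  Discrete.ext (Discrete.eq_of_hom (X := (x : Discrete J)) (Y := (y : Discrete J)) h)

theorem disc_hom_ext {f g : disc J ⟶ X} (h : ∀ j : J, app f ⟨j⟩ = app g ⟨j⟩) : f = g := by
  refine hom_ext (CategoryTheory.Functor.ext (fun j : Discrete J => h j.as) fun j k ζ => ?_)
  obtain rfl := disc_eq_of_hom ζ
  obtain rfl : ζ = 𝟙 j := Subsingleton.elim _ _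
  simpa using ((eqToHom_trans _ _).trans (eqToHom_refl _ _)).symm

/-- The morphism from a discrete groupoid given by a family of fixed points. -/
def discMap (o : J → X.Fix) : disc J ⟶ X where
  functor := Discrete.functor fun j => (o j).1
  comm := by
    refine CategoryTheory.Functor.ext (fun j : Discrete J => (o j.as).2.symm) fun j k ζ => ?_
    obtain rfl := disc_eq_of_hom ζ
    obtain rfl : ζ = 𝟙 j := Subsingleton.elim _ _
    simpa using ((eqToHom_trans _ _).trans (eqToHom_refl _ _)).symm

theorem disc_faithful (f : disc J ⟶ X) : (Hom.functor f).Faithful :=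
  ⟨fun _ => Subsingleton.elim _ _⟩

/-- The object of a discrete groupoid as a fixed point. -/
def discFix (j : J) : (disc J).Fix := ⟨⟨j⟩, rfl⟩

/-- The morphism between discrete groupoids given by a map. -/
def discHom (φ : J → K) : disc J ⟶ disc K := discMap fun j => discFix (φ j)

end Discrete

end InvGpd

open InvGpd

/-! ### The closed type of integers. -/

section Integers

variable (κ : Cardinal.{u}) (hκ : κ.IsInaccessible)

/-- The type of integers, as a fixed point of the universe. -/
def intFix : (UΔ κ).Fix := ⟨intObj κ hκ, rfl⟩

/-- The integers as fixed points of the universal type. -/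
def ptIntFix (n : ℤ) : (PtUΔ κ).Fix := ⟨ptIntObj κ hκ n, rfl⟩

/-- The type of integers. -/
def intType : disc PUnit ⟶ UΔ κ := discMap fun _ => intFix κ hκ

/-- The elements of the type of integers. -/
def intElements : disc (ULift.{u + 1} ℤ) ⟶ PtUΔ κ := discMap fun n => ptIntFix κ hκ n.down

theorem ptIntObj_injective : Function.Injective (ptIntObj κ hκ) := by
  intro m n h
  injection h with _ h
  exact congrArg ULift.down h

/-- The involution of the universal type sends the point `n` over `(ℤ, ℤ, id)` to its image under
the identity, so every element is fixed and the fibre is a set with trivial involution. Hence any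
permutation of the integers is an automorphism of this closed type. -/
theorem isPullback_intElements : IsPullback (discHom fun _ => PUnit.unit) (intElements κ hκ)
    (intType κ hκ) (pΔ κ) := by
  refine isPullback_of_faithful (disc_hom_ext fun _ => rfl) (disc_faithful _)
    (isDiscFib_pΔ κ).faithful ?_ ?_ ?_
  · rintro x ⟨A, a⟩ (rfl : intObj κ hκ = A)
    exact ⟨⟨⟨ULift.down a⟩⟩, rfl, rfl⟩
  · rintro ⟨⟨m⟩⟩ ⟨⟨n⟩⟩ _ h
    obtain rfl := ptIntObj_injective κ hκ h
    rfl
  · rintro ⟨⟨m⟩⟩ ⟨⟨n⟩⟩ ξ α hα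
    have e : (Hom.functor (intType κ hκ)).map ξ = 𝟙 (intObj κ hκ) :=
      (congrArg (Hom.functor (intType κ hκ)).map
        (Subsingleton.elim ξ (𝟙 _))).trans (CategoryTheory.Functor.map_id _ _)
    rw [e] at hα
    obtain rfl := ptIntObj_injective κ hκ ((isDiscFib_pΔ κ).eq_of_lift_id α hα)
    exact ⟨𝟙 _, Subsingleton.elim _ _⟩

end Integers

/-! ### Negation as a fixed point of the space of equivalences, and the conclusion. -/

section

variable {κ : Cardinal.{u}} (I : EquivData projFib (pΔ κ))

/-- Application of the underlying function of an equivalence, in terms of morphisms. -/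
theorem EquivData.sendsTo_of_app_eq {Y : InvGpd.{u + 1}} (e : Y ⟶ I.space) (x x' : Y ⟶ PtUΔ κ)
    (hx : (e ≫ I.toHom) ≫ I.hom.pi.proj ≫ I.tyA = x ≫ pΔ κ) (h : I.hom.app (e ≫ I.toHom) x hx = x')
    (y : Y.carrier) : I.SendsTo (app e y) (app x y) (app x' y) := by
  have hd : (e ≫ I.toHom) ≫ I.hom.pi.proj = I.hom.dom.lift ((e ≫ I.toHom) ≫ I.hom.pi.proj) x
      (by simpa using hx) ≫ I.hom.dom.proj := by rw [PullbackData.lift_proj]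
  -- The morphism `m` pairs the function with its argument; its value at `y` is the witness required
  -- by `SendsTo`.
  obtain ⟨m, hm⟩ : ∃ m, m = I.hom.pi.pb.lift (e ≫ I.toHom) _ hd := ⟨_, rfl⟩
  have h₁ : m ≫ I.hom.pi.pb.proj = e ≫ I.toHom := by rw [hm, PullbackData.lift_proj]
  have h₂ : m ≫ I.hom.pi.pb.top ≫ I.hom.dom.top = x := by
    rw [← Category.assoc, hm, PullbackData.lift_top, PullbackData.lift_top]
  have h₃ : m ≫ I.hom.pi.ev ≫ I.hom.cod.top = x' := by
    rw [← Category.assoc, hm]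
    exact h
  exact ⟨app m y, app_congr h₁ y, app_congr h₂ y, app_congr h₃ y⟩

/-- Negation is its own inverse, so it yields a term of `Equiv` over the one-point context, that is,
a fixed point. If a fixed point of the universe induced it, the underlying function would be an
identity, yet it sends `1` to `-1`. -/
theorem EquivData.exists_negation (hκ : κ.IsInaccessible) :
    ∃ e : I.space.Fix,
      app (I.toBase ≫ I.tyA) e.1 = intObj κ hκ ∧
      app (I.toBase ≫ I.tyB) e.1 = intObj κ hκ ∧
      (∀ n : ℤ, I.SendsTo e.1 (ptIntObj κ hκ n) (ptIntObj κ hκ (-n))) ∧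
      e ∉ Set.range (mapFix I.idEquiv) := by
  let σ : disc (ULift.{u + 1} ℤ) ⟶ disc (ULift.{u + 1} ℤ) := discHom fun n => ⟨-n.down⟩
  have hσ : σ ≫ σ = 𝟙 _ := disc_hom_ext fun n =>
    congrArg (fun m : ℤ => (⟨⟨m⟩⟩ : Discrete (ULift.{u + 1} ℤ))) (neg_neg n.down)
  obtain ⟨e, heA, heB, he⟩ := I.exists_of_automorphism (isPullback_intElements κ hκ) (σ := σ)
    (τ := σ) (disc_hom_ext fun _ => rfl) (disc_hom_ext fun _ => rfl) hσ hσ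
  have hy : ∀ y : disc PUnit.{u + 2} ⟶ disc (ULift.{u + 1} ℤ),
      y ≫ (discHom fun _ => PUnit.unit) = 𝟙 (disc PUnit.{u + 2}) := fun y => disc_hom_ext fun _ => rfl
  have happ : ∀ (y : disc PUnit.{u + 2} ⟶ disc (ULift.{u + 1} ℤ)) (hx : (e ≫ I.toHom) ≫
      I.hom.pi.proj ≫ I.tyA = (y ≫ intElements κ hκ) ≫ pΔ κ),
      I.hom.app (e ≫ I.toHom) (y ≫ intElements κ hκ) hx = y ≫ σ ≫ intElements κ hκ := by
    intro y
    have := he y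
    rw [reassoc_of% hy y] at this
    exact this
  have hA : (e ≫ I.toHom) ≫ I.hom.pi.proj ≫ I.tyA = intType κ hκ := by
    rw [← heA]; simp only [Category.assoc]
  have hx : ∀ y : disc PUnit.{u + 2} ⟶ disc (ULift.{u + 1} ℤ), (e ≫ I.toHom) ≫
      I.hom.pi.proj ≫ I.tyA = (y ≫ intElements κ hκ) ≫ pΔ κ := fun y =>
    hA.trans (disc_hom_ext fun _ => rfl)
  let num (n : ℤ) : disc PUnit.{u + 2} ⟶ disc (ULift.{u + 1} ℤ) := discHom fun _ => ⟨n⟩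
  refine ⟨mapFix e (discFix PUnit.unit), app_congr heA _, app_congr heB _, fun n => ?_, ?_⟩
  · exact I.sendsTo_of_app_eq e _ _ (hx (num n)) (happ (num n) (hx (num n))) ⟨PUnit.unit⟩
  · rintro ⟨x, hxe⟩
    -- The supposed preimage `x` is viewed as a closed type. As the equivalence lies over the
    -- integers, this type must be `intType` (`h₃`), so the identity function can be evaluated at
    -- the number `1`.
    let ξ : disc PUnit.{u + 2} ⟶ UΔ κ := discMap fun _ => x
    have h₁ : ξ ≫ I.idEquiv = e := disc_hom_ext fun _ => congrArg Subtype.val hxe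
    have h₂ : e ≫ I.toHom = ξ ≫ I.idHom := by
      rw [← h₁, Category.assoc, I.idEquiv_toHom]
    have h₃ : ξ = intType κ hκ := by
      rw [← hA, h₂, Category.assoc, FunctionsData.idHom_tyA, Category.comp_id]
    have h₄ : I.hom.app (e ≫ I.toHom) (num 1 ≫ intElements κ hκ) (hx _) =
        num 1 ≫ intElements κ hκ := by
      refine I.hom.app_idFun I.diag I.diag_tyA I.diag_tyB _ _ ?_ _
      change e ≫ I.toHom = _ ≫ _ ≫ I.idHom
      rw [h₂, ← Category.assoc, ← hx, hA, h₃]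
    have h₅ := app_congr ((happ (num 1) (hx _)).symm.trans h₄) ⟨PUnit.unit⟩
    have h₆ := ptIntObj_injective κ hκ h₅
    change (-1 : ℤ) = 1 at h₆
    omega

end

theorem mainTheorem7 (κ : Cardinal.{u}) (hκ : κ.IsInaccessible) :
    Nonempty (EquivData InvGpd.projFib (pΔ κ)) ∧
    ¬ IsUnivalent InvGpd.projFib (pΔ κ) ∧
    ∀ I : EquivData InvGpd.projFib (pΔ κ),
      (∃ e : I.space.Fix,
        InvGpd.app (I.toBase ≫ I.tyA) e.1 = intObj κ hκ ∧
        InvGpd.app (I.toBase ≫ I.tyB) e.1 = intObj κ hκ ∧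
        (∀ n : ℤ, I.SendsTo e.1 (ptIntObj κ hκ n) (ptIntObj κ hκ (-n))) ∧
        e ∉ Set.range (InvGpd.mapFix I.idEquiv)) ∧
      ¬ Function.Bijective (InvGpd.mapFix I.idEquiv) ∧
      ¬ IsHomotopyEquiv InvGpd.projFib I.idEquiv := by
  have not_surjective : ∀ I : EquivData InvGpd.projFib (pΔ κ),
      ¬ Function.Surjective (InvGpd.mapFix I.idEquiv) := by
    intro I h
    obtain ⟨e, -, -, -, he⟩ := I.exists_negation hκ
    exact he (h e)
  refine ⟨⟨equivData (pΔ κ) (isDiscFib_pΔ κ)⟩, ?_, fun I => ⟨I.exists_negation hκ, ?_, ?_⟩⟩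
  -- Univalence asks for some interpretation, so its negation uses the failure of surjectivity for
  -- all of them.
  · rintro ⟨I, hI⟩
    exact not_surjective I (mapFix_surjective_of_isHomotopyEquiv hI)
  · exact fun h => not_surjective I h.surjective
  · exact fun h => not_surjective I (mapFix_surjective_of_isHomotopyEquiv h)
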